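/- For momenta $p_1,p_2,p_3\in\mathbb R^4$ with $p_1+p_2+p_3=0$ let $\Gamma_{\mu\nu\rho}(p_1,p_2,p_3)$, $\mu,\nu,\rho\in\{0,1,2,3\}$, be a real- or complex-valued three-point amplitude of an axial vector field. That is, $\Gamma$ is a function on the space of momentum-conserving triples such that (i) ($O(4)$ covariance) for all $R\in O(4)$, $$\Gamma_{\mu\nu\rho}(Rp_1,Rp_2,Rp_3)=(\det R)^3\,R_{\mu\mu'}R_{\nu\nu'}R_{\rho\rho'}\,\Gamma_{\mu'\nu'\rho'}(p_1,p_2,p_3)$$ (repeated indices are summed); (ii) (full Bose symmetry) $\Gamma$ is invariant under the six simultaneous permutations of $(p_1,\mu),(p_2,\nu),(p_3,\rho)$. Let $\varepsilon_{\alpha\beta\gamma\delta}$ be the Levi-Civita tensor, and for a function $F$ of three real variables write $F(i,j,k)=F(p_i^2,p_j^2,p_k^2)$. (a) There are two functions $A,B$ of three real variables, with real or complex values respectively, such that $$A(x,y,z)=A(z,y,x),\qquad A(x,y,z)+A(y,z,x)+A(z,x,y)=0$$ for all $x,y,z$, and such that for all $p_1+p_2+p_3=0$ and all $\mu,\nu,\rho$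 $$\begin{aligned}\Gamma_{\mu\nu\rho}(p_1,p_2,p_3)={}&[A(1,2,3)\,p_1^\tau-A(2,1,3)\,p_2^\tau]\,\varepsilon_{\tau\mu\nu\rho}\\ &+[B(1,2,3)\,p_{3\nu}+B(3,2,1)\,p_{1\nu}]\,\varepsilon_{\alpha\beta\rho\mu}\,p_1^\alpha p_2^\beta\\ &+[B(3,1,2)\,p_{2\mu}+B(2,1,3)\,p_{3\mu}]\,\varepsilon_{\alpha\beta\nu\rho}\,p_1^\alpha p_2^\beta\\ &+[B(2,3,1)\,p_{1\rho}+B(1,3,2)\,p_{2\rho}]\,\varepsilon_{\alpha\beta\mu\nu}\,p_1^\alpha p_2^\beta .\end{aligned}$$ (b) If $\Gamma$ is (real-)analytic at zero momentum, then it has no relevant local contribution: assigning mass dimension $3+n$ to the local contribution of order $n$ in the momenta, i.e. to the derivative of order $n$ of $\Gamma$ at zero momentum, all contributions of mass dimension at most $4$ vanish. In other words, $\Gamma$ and all its first derivatives vanish at zero momentum. -/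

import Mathlib

/-- Euclidean space-time momenta. -/
abbrev Momentum : Type := EuclideanSpace ℝ (Fin 4)

/-- The space of triples `(p₁, p₂, p₃)` of momenta with `p₁ + p₂ + p₃ = 0`.
The momenta `p₁, p₂, p₃` are `p.1 0, p.1 1, p.1 2`. -/
def conservedTriples : Submodule ℝ (Fin 3 → Momentum) where
  carrier := {p | ∑ i, p i = 0}
  add_mem' := by
    intro p q hp hq
    simp only [Set.mem_ofPred_eq, Pi.add_apply, Finset.sum_add_distrib] at *
    rw [hp, hq, add_zero]
  zero_mem' := by simp
  smul_mem' := by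
    intro c p hp
    simp only [Set.mem_ofPred_eq, Pi.smul_apply, ← Finset.smul_sum] at *
    rw [hp, smul_zero]

/-- The simultaneous action of a matrix on the three momenta. -/
noncomputable def rotateMomenta (R : Matrix (Fin 4) (Fin 4) ℝ) (p : conservedTriples) : conservedTriples :=
  ⟨fun i => Matrix.toEuclideanLin R (p.1 i), by
    change ∑ i, Matrix.toEuclideanLin R (p.1 i) = 0
    rw [← map_sum, show ∑ i, p.1 i = 0 from p.2, map_zero]⟩

/-- Permutation of the three momenta. -/
def permuteMomenta (σ : Equiv.Perm (Fin 3)) (p : conservedTriples) : conservedTriples :=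
  ⟨fun i => p.1 (σ i), by
    change ∑ i, p.1 (σ i) = 0
    rw [Equiv.sum_comp σ p.1]
    exact p.2⟩

/-- The space of values of an amplitude with three tensor indices `(μ, ν, ρ)`; a multi-index is
`m : Fin 3 → Fin 4` with `μ = m 0`, `ν = m 1`, `ρ = m 2`. -/
abbrev ThreeTensor (𝕜 : Type*) : Type _ := (Fin 3 → Fin 4) → 𝕜

/-- Covariance under the full Euclidean group `O(4)` of a three-point function of an axial vector
field `A_μ`. Such a field transforms with the matrix `det R • R`, so that the three-point function
acquires the factor `(det R) ^ 3 = det R`. -/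
def IsAxialCovariant {𝕜 : Type*} [RCLike 𝕜] (Γ : conservedTriples → ThreeTensor 𝕜) : Prop :=
  ∀ R ∈ Matrix.orthogonalGroup (Fin 4) ℝ, ∀ (p : conservedTriples) (m : Fin 3 → Fin 4),
    Γ (rotateMomenta R p) m =
      ∑ n : Fin 3 → Fin 4, ((∏ j, (R.det * R (m j) (n j)) : ℝ) : 𝕜) * Γ p n

/-- Full Bose symmetry: invariance under the six simultaneous permutations of
`(p₁, μ), (p₂, ν), (p₃, ρ)`. -/
def IsBoseSymmetric {𝕜 : Type*} [RCLike 𝕜] (Γ : conservedTriples → ThreeTensor 𝕜) : Prop :=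
  ∀ (σ : Equiv.Perm (Fin 3)) (p : conservedTriples) (m : Fin 3 → Fin 4),
    Γ (permuteMomenta σ p) (fun i => m (σ i)) = Γ p m

/-- The Levi-Civita tensor `ε_{αβγδ}` in four dimensions, the determinant of the matrix whose rows
are the standard unit vectors `e_α, e_β, e_γ, e_δ`. -/
noncomputable def leviCivita (α β γ δ : Fin 4) : ℝ :=
  ((1 : Matrix (Fin 4) (Fin 4) ℝ).submatrix ![α, β, γ, δ] id).det

/-- `ε_{αβμν} p^α q^β`, summed over `α` and `β`. -/
noncomputable def leviCivitaContract (p q : Momentum) (μ ν : Fin 4) : ℝ :=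
  ∑ α, ∑ β, leviCivita α β μ ν * p α * q β

/-- `F(i,j,k) = F(p_i², p_j², p_k²)`. -/
noncomputable def atSquares {𝕜 : Type*} (F : ℝ → ℝ → ℝ → 𝕜) (p : conservedTriples) (i j k : Fin 3) : 𝕜 :=
  F (‖p.1 i‖ ^ 2) (‖p.1 j‖ ^ 2) (‖p.1 k‖ ^ 2)

/-- The tensor built from two scalar functions `A`, `B` of the squared momenta. The indices
`0, 1, 2` stand for the labels `1, 2, 3` of the momenta. -/
noncomputable def axialForm {𝕜 : Type*} [RCLike 𝕜] (A B : ℝ → ℝ → ℝ → 𝕜) (p : conservedTriples)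
    (μ ν ρ : Fin 4) : 𝕜 :=
  (∑ τ, (atSquares A p 0 1 2 * ((p.1 0 τ : ℝ) : 𝕜) - atSquares A p 1 0 2 * ((p.1 1 τ : ℝ) : 𝕜)) *
      ((leviCivita τ μ ν ρ : ℝ) : 𝕜))
  + (atSquares B p 0 1 2 * ((p.1 2 ν : ℝ) : 𝕜) + atSquares B p 2 1 0 * ((p.1 0 ν : ℝ) : 𝕜)) *
      ((leviCivitaContract (p.1 0) (p.1 1) ρ μ : ℝ) : 𝕜)
  + (atSquares B p 2 0 1 * ((p.1 1 μ : ℝ) : 𝕜) + atSquares B p 1 0 2 * ((p.1 2 μ : ℝ) : 𝕜)) *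
      ((leviCivitaContract (p.1 0) (p.1 1) ν ρ : ℝ) : 𝕜)
  + (atSquares B p 1 2 0 * ((p.1 0 ρ : ℝ) : 𝕜) + atSquares B p 0 2 1 * ((p.1 1 ρ : ℝ) : 𝕜)) *
      ((leviCivitaContract (p.1 0) (p.1 1) μ ν : ℝ) : 𝕜)

/-- The symmetry relations of the scalar function `A`. -/
def HasBoseRelations {𝕜 : Type*} [RCLike 𝕜] (A : ℝ → ℝ → ℝ → 𝕜) : Prop :=
  (∀ x y z, A x y z = A z y x) ∧ ∀ x y z, A x y z + A y z x + A z x y = 0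

/-- The local contribution of order `n` in the momenta to the three-point function of a field of
mass dimension `1` has mass dimension `3 + n`; it is given by the derivative of order `n` at
vanishing momentum. It is relevant if its mass dimension is at most `4`. -/
def HasNoRelevantLocalPart {𝕜 : Type*} [RCLike 𝕜] (Γ : conservedTriples → ThreeTensor 𝕜) : Prop :=
  ∀ n : ℕ, 3 + n ≤ 4 → iteratedFDeriv ℝ n Γ 0 = 0

open Matrix

/-! The three lengths of a conserved triple determine its Gram matrix, so two triples with equal
lengths differ by a rotation in `O(4)`, and every `O(4)`-invariant is a function of the squared
momenta. Such invariants arise by contracting `Γ` with explicit axially covariant tensors, and `A`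
and `B` are read off from these contractions.

Reflections and coordinate transpositions that fix the momenta act on `Γ` with a sign, leaving few
independent components. For collinear momenta only a multiple of `ε(v, ·, ·, ·)` survives.
Contracting `Γ` with `ε(p₂ - p₃, ·, ·, ·)` gives a function `F` whose Bose relations become those of
`A` after a permutation of its arguments and division by a multiple of `p₁² + p₂² + p₃²`; the
resulting `A`-tensor agrees with `Γ` on all collinear triples (`exists_axial_part`). It is itself
covariant and Bose symmetric, so it can be subtracted everywhere.

The remainder vanishes at collinear triples, as does every `B`-tensor. Elsewhere the momenta span a
plane, rotated onto the first two axes. By the sign rules and Bose symmetry only `Γ_{i23}`, `i = 0,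
1`, matter. Contraction with a vector orthogonal to `p₃` in that plane isolates `B(3,1,2)`, and the
exchange of `p₂` and `p₃` supplies the second equation (`exists_planar_part`).

For (b), `-1 ∈ O(4)` has determinant `1` and acts on rank three by `-1`, so `Γ 0 = 0`. The first
derivative inherits both symmetries; on collinear triples it has the `A`-form, and linearity
together with the cyclic relation for `A` makes it zero (`eq_zero_of_linear`). -/

/-! ### Rotations of momenta and their invariants -/

theorem sum_conservedTriples (p : conservedTriples) :
    p.1 0 + p.1 1 + p.1 2 = 0 := by
  have h : ∑ i, p.1 i = 0 := p.2
  rwa [Fin.sum_univ_three] at h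

theorem rotateMomenta_apply (R : Matrix (Fin 4) (Fin 4) ℝ) (p : conservedTriples) (i : Fin 3) :
    (rotateMomenta R p).1 i = toEuclideanLin R (p.1 i) := rfl

theorem rotateMomenta_coord (R : Matrix (Fin 4) (Fin 4) ℝ) (p : conservedTriples) (i : Fin 3)
    (k : Fin 4) : (rotateMomenta R p).1 i k = ∑ l, R k l * p.1 i l := rfl

theorem permuteMomenta_apply (σ : Equiv.Perm (Fin 3)) (p : conservedTriples) (i : Fin 3) :
    (permuteMomenta σ p).1 i = p.1 (σ i) := rfl

theorem rotateMomenta_mul (R S : Matrix (Fin 4) (Fin 4) ℝ) (p : conservedTriples) :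
    rotateMomenta R (rotateMomenta S p) = rotateMomenta (R * S) p := by
  ext i k
  simp only [rotateMomenta_apply]
  simp [toEuclideanLin, toLpLin_apply, mulVec_mulVec]

theorem rotateMomenta_one (p : conservedTriples) : rotateMomenta 1 p = p := by
  ext i k
  simp [rotateMomenta_apply, toEuclideanLin]

theorem inner_toEuclideanLin_of_mem_orthogonalGroup {R : Matrix (Fin 4) (Fin 4) ℝ}
    (hR : R ∈ orthogonalGroup (Fin 4) ℝ) (u v : Momentum) :
    inner ℝ (toEuclideanLin R u) (toEuclideanLin R v) = inner ℝ u v := by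
  have h : Rᵀ * R = 1 := (mem_orthogonalGroup_iff' _ _).1 hR
  simp only [EuclideanSpace.inner_eq_star_dotProduct, toEuclideanLin, toLpLin_apply, star_trivial]
  rw [dotProduct_mulVec, vecMul_mulVec, h, vecMul_one]

theorem norm_rotateMomenta {R : Matrix (Fin 4) (Fin 4) ℝ}
    (hR : R ∈ orthogonalGroup (Fin 4) ℝ) (p : conservedTriples) (i : Fin 3) :
    ‖(rotateMomenta R p).1 i‖ = ‖p.1 i‖ := by
  rw [rotateMomenta_apply, ← sq_eq_sq₀ (norm_nonneg _) (norm_nonneg _),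
    ← real_inner_self_eq_norm_sq, ← real_inner_self_eq_norm_sq,
    inner_toEuclideanLin_of_mem_orthogonalGroup hR]

theorem exists_orthogonal_of_linearIsometry (φ : Momentum →ₗᵢ[ℝ] Momentum) :
    ∃ R ∈ orthogonalGroup (Fin 4) ℝ, ∀ v, toEuclideanLin R v = φ v := by
  have hφ : toEuclideanLin (toEuclideanLin.symm φ.toLinearMap) = φ.toLinearMap :=
    LinearEquiv.apply_symm_apply _ _
  refine ⟨toEuclideanLin.symm φ.toLinearMap, ?_, fun v => by rw [hφ]; rfl⟩
  set R := (toEuclideanLin (𝕜 := ℝ)).symm φ.toLinearMap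
  rw [mem_orthogonalGroup_iff']
  ext i j
  have h := φ.inner_map_map (EuclideanSpace.single i (1 : ℝ)) (EuclideanSpace.single j (1 : ℝ))
  have hc : ∀ i k, φ (EuclideanSpace.single i (1 : ℝ)) k = R k i := by
    intro i k
    have := congrArg (fun f : Momentum →ₗ[ℝ] Momentum => f (EuclideanSpace.single i (1 : ℝ)) k) hφ
    simp only [LinearIsometry.coe_toLinearMap] at this
    rw [← this]
    simp [toEuclideanLin, toLpLin_apply]
  rw [EuclideanSpace.inner_eq_star_dotProduct] at h
  simp only [dotProduct, star_trivial, hc] at h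
  simp only [mul_apply, transpose_apply]
  rw [Finset.sum_congr rfl fun k _ => mul_comm (R k i) (R k j), h]
  simp [EuclideanSpace.inner_single_left, one_apply]

/-- Equality of norms makes `L c ↦ L' c` a well-defined isometry on the range of `L`, which extends
to the whole finite-dimensional space. Dependent vectors need no separate treatment. -/
theorem exists_orthogonal_of_norm_linearMap_eq {V : Type*} [AddCommGroup V] [Module ℝ V]
    (L L' : V →ₗ[ℝ] Momentum) (h : ∀ c, ‖L c‖ = ‖L' c‖) :
    ∃ R ∈ orthogonalGroup (Fin 4) ℝ, ∀ c, toEuclideanLin R (L c) = L' c := by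
  obtain ⟨g, hg⟩ := L.rangeRestrict.exists_rightInverse_of_surjective (LinearMap.range_rangeRestrict L)
  have hg' : ∀ u, L (g u) = u := fun u => congrArg Subtype.val (LinearMap.congr_fun hg u)
  let φ : LinearMap.range L →ₗᵢ[ℝ] Momentum :=
    ⟨L' ∘ₗ g, fun u => by simp only [LinearMap.comp_apply]; rw [← h, hg']; rfl⟩
  obtain ⟨R, hR, hRφ⟩ := exists_orthogonal_of_linearIsometry φ.extend
  refine ⟨R, hR, fun c => ?_⟩
  have h1 : φ.extend (L c) = φ ⟨L c, c, rfl⟩ := φ.extend_apply ⟨L c, c, rfl⟩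
  rw [hRφ, h1, ← sub_eq_zero]
  change L' (g _) - L' c = 0
  rw [← map_sub, ← norm_eq_zero, ← h, map_sub, hg', sub_self, norm_zero]

/-- The length of `p₃ = -(p₁ + p₂)` fixes the inner product of `p₁` and `p₂` by polarization, hence
the norm of every combination of the two. -/
theorem exists_orthogonal_of_norm_eq {p q : conservedTriples}
    (h : ∀ i, ‖p.1 i‖ = ‖q.1 i‖) :
    ∃ R ∈ orthogonalGroup (Fin 4) ℝ, rotateMomenta R p = q := by
  let L : conservedTriples → (ℝ × ℝ) →ₗ[ℝ] Momentum := fun p =>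
    (LinearMap.toSpanSingleton ℝ Momentum (p.1 0)).coprod
      (LinearMap.toSpanSingleton ℝ Momentum (p.1 1))
  have hL : ∀ p c, L p c = c.1 • p.1 0 + c.2 • p.1 1 := fun p c => by simp [L]
  have h2 : ∀ p : conservedTriples, p.1 2 = -(p.1 0 + p.1 1) := fun p =>
    eq_neg_of_add_eq_zero_right (sum_conservedTriples p)
  have hn : ∀ c, ‖L p c‖ = ‖L q c‖ := by
    intro c
    have h3 := h 2
    rw [h2, h2, norm_neg, norm_neg, ← sq_eq_sq₀ (norm_nonneg _) (norm_nonneg _),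
      norm_add_sq_real, norm_add_sq_real, h 0, h 1] at h3
    rw [← sq_eq_sq₀ (norm_nonneg _) (norm_nonneg _), hL, hL, norm_add_sq_real, norm_add_sq_real]
    simp only [norm_smul, inner_smul_left, inner_smul_right, h 0, h 1]
    have : inner ℝ (p.1 0) (p.1 1) = inner ℝ (q.1 0) (q.1 1) := by linarith
    rw [this]
  obtain ⟨R, hR, hRL⟩ := exists_orthogonal_of_norm_linearMap_eq (L p) (L q) hn
  have h0 := hRL (1, 0)
  have h1 := hRL (0, 1)
  simp only [hL, one_smul, zero_smul, add_zero, zero_add] at h0 h1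
  refine ⟨R, hR, Subtype.ext (funext fun i => ?_)⟩
  rw [rotateMomenta_apply]
  fin_cases i
  · exact h0
  · exact h1
  · change toEuclideanLin R (p.1 2) = q.1 2
    rw [h2, h2, map_neg, map_add, h0, h1]

/-- An invariant of momentum-conserving triples is a function of the squared momenta. -/
theorem exists_eq_norm_sq_of_invariant {α : Type*} [Zero α] (f : conservedTriples → α)
    (hf : ∀ R ∈ orthogonalGroup (Fin 4) ℝ, ∀ p, f (rotateMomenta R p) = f p) :
    ∃ F : ℝ → ℝ → ℝ → α, (∀ p, F (‖p.1 0‖ ^ 2) (‖p.1 1‖ ^ 2) (‖p.1 2‖ ^ 2) = f p) ∧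
      ∀ x y z, (¬ ∃ p : conservedTriples, ‖p.1 0‖ ^ 2 = x ∧ ‖p.1 1‖ ^ 2 = y ∧ ‖p.1 2‖ ^ 2 = z) →
        F x y z = 0 := by
  classical
  -- The value `0` off the realizable triples lets relations between permuted arguments of `F` hold
  -- everywhere, since realizability is itself invariant under permutations.
  refine ⟨fun x y z =>
    if h : ∃ p : conservedTriples, ‖p.1 0‖ ^ 2 = x ∧ ‖p.1 1‖ ^ 2 = y ∧ ‖p.1 2‖ ^ 2 = z
    then f h.choose else 0, fun p => ?_, fun x y z h => dif_neg h⟩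
  have h : ∃ q : conservedTriples, ‖q.1 0‖ ^ 2 = ‖p.1 0‖ ^ 2 ∧ ‖q.1 1‖ ^ 2 = ‖p.1 1‖ ^ 2 ∧
      ‖q.1 2‖ ^ 2 = ‖p.1 2‖ ^ 2 := ⟨p, rfl, rfl, rfl⟩
  simp only [dif_pos h]
  obtain ⟨R, hR, hRp⟩ := exists_orthogonal_of_norm_eq (p := p) (q := h.choose) (by
    obtain ⟨h0, h1, h2⟩ := h.choose_spec
    intro i
    rw [← sq_eq_sq₀ (norm_nonneg _) (norm_nonneg _)]
    fin_cases i
    exacts [h0.symm, h1.symm, h2.symm])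
  rw [← hRp, hf R hR]

/-- Every momentum-conserving triple can be rotated into the plane of the first two axes. -/
theorem exists_orthogonal_planar (p : conservedTriples) :
    ∃ R ∈ orthogonalGroup (Fin 4) ℝ, ∀ i, (rotateMomenta R p).1 i 2 = 0 ∧
      (rotateMomenta R p).1 i 3 = 0 := by
  -- Gram–Schmidt coordinates are triangular: the first two vectors have no components beyond the
  -- second basis vector.
  let f : Fin 4 → Momentum := ![p.1 0, p.1 1, 0, 0]
  let b := InnerProductSpace.gramSchmidtOrthonormalBasis (𝕜 := ℝ) (by simp) f
  have hb : ∀ i j, i < j → b.repr (f i) j = 0 := fun i j hij =>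
    InnerProductSpace.gramSchmidtOrthonormalBasis_inv_triangular' _ f hij
  obtain ⟨R, hR, hRb⟩ := exists_orthogonal_of_linearIsometry b.repr.toLinearIsometry
  refine ⟨R, hR, fun i => ?_⟩
  simp only [rotateMomenta_apply, hRb, LinearIsometryEquiv.coe_toLinearIsometry]
  have h2 : p.1 2 = -(p.1 0 + p.1 1) := eq_neg_of_add_eq_zero_right (sum_conservedTriples p)
  have h02 := hb 0 2 (by decide)
  have h03 := hb 0 3 (by decide)
  have h12 := hb 1 2 (by decide)
  have h13 := hb 1 3 (by decide)
  simp only [f, Matrix.cons_val_zero, Matrix.cons_val_one] at h02 h03 h12 h13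
  fin_cases i
  · exact ⟨h02, h03⟩
  · exact ⟨h12, h13⟩
  · change b.repr (p.1 2) 2 = 0 ∧ b.repr (p.1 2) 3 = 0
    simp [h2, h02, h03, h12, h13]

/-! ### Covariant tensors from equivariant multilinear forms -/

theorem det_sq_of_mem_orthogonalGroup {R : Matrix (Fin 4) (Fin 4) ℝ}
    (hR : R ∈ orthogonalGroup (Fin 4) ℝ) : R.det ^ 2 = 1 := by
  have h := congrArg det ((mem_orthogonalGroup_iff _ _).1 hR)
  rw [det_mul, det_transpose, det_one] at h
  rw [sq, h]

theorem MultilinearMap.eq_sum_single {𝕜 : Type*} {n k : ℕ} [CommSemiring 𝕜]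
    {M : Type*} [AddCommMonoid M] [Module 𝕜 M]
    (f : MultilinearMap 𝕜 (fun _ : Fin k => Fin n → 𝕜) M) (v : Fin k → Fin n → 𝕜) :
    f v = ∑ m : Fin k → Fin n, (∏ j, v j (m j)) • f fun j => Pi.single (m j) 1 := by
  have h : v = fun j => ∑ i, v j i • (Pi.single i (1 : 𝕜) : Fin n → 𝕜) := by
    funext j i
    simp [Finset.sum_apply, Pi.single_apply]
  conv_lhs => rw [h]
  rw [MultilinearMap.map_sum]
  exact Finset.sum_congr rfl fun m _ => f.map_smul_univ _ _

/-- A tensor field that is given by equivariant multilinear forms with values in pseudoscalars is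
axially covariant. -/
theorem isAxialCovariant_of_multilinear
    (f : conservedTriples → MultilinearMap ℝ (fun _ : Fin 3 => Fin 4 → ℝ) ℝ)
    (hf : ∀ R ∈ orthogonalGroup (Fin 4) ℝ, ∀ p v,
      f (rotateMomenta R p) (fun j => R *ᵥ v j) = R.det * f p v) :
    IsAxialCovariant (𝕜 := ℝ) fun p m => f p fun j => Pi.single (m j) 1 := by
  intro R hR p m
  -- Orthogonality sends the rows of `R` to the unit vectors, so equivariance evaluated at the rows
  -- gives the required components.
  have h1 : ∀ j : Fin 3, R *ᵥ (R (m j)) = Pi.single (m j) 1 := by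
    intro j
    have h := (mem_orthogonalGroup_iff _ _).1 hR
    ext k
    have := congrFun (congrFun h k) (m j)
    simpa [mul_apply, star_apply, mulVec, dotProduct, one_apply, Pi.single_apply] using this
  have h2 := hf R hR p fun j => R (m j)
  simp only [h1] at h2
  beta_reduce
  rw [h2, (f p).eq_sum_single, Finset.mul_sum]
  refine Finset.sum_congr rfl fun n _ => ?_
  have h3 := det_sq_of_mem_orthogonalGroup hR
  rw [Finset.prod_mul_distrib, Finset.prod_const, Finset.card_univ, Fintype.card_fin, smul_eq_mul,
    RCLike.ofReal_real_eq_id, id, pow_succ, h3]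
  ring

/-- The three-form `v ↦ ε(w, v₀, v₁, v₂)`. -/
noncomputable def volumeForm₁ (w : Fin 4 → ℝ) :
    MultilinearMap ℝ (fun _ : Fin 3 => Fin 4 → ℝ) ℝ :=
  (detRowAlternating (n := Fin 4) (R := ℝ)).toMultilinearMap.curryLeft w

theorem volumeForm₁_apply (w : Fin 4 → ℝ) (v : Fin 3 → Fin 4 → ℝ) :
    volumeForm₁ w v = det (of (Fin.cons w v : Fin 4 → Fin 4 → ℝ)) := by
  rw [volumeForm₁, MultilinearMap.curryLeft_apply]
  rfl

/-- The trilinear form `v ↦ ⟨w, v₀⟩ ε(p, q, v₁, v₂)`. -/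
noncomputable def tensorVolumeForm₂ (w p q : Fin 4 → ℝ) :
    MultilinearMap ℝ (fun _ : Fin 3 => Fin 4 → ℝ) ℝ :=
  LinearMap.uncurryLeft (M := fun _ : Fin 3 => Fin 4 → ℝ)
    ((dotProductBilin ℝ ℝ w).smulRight ((volumeForm₁ p).curryLeft q))

theorem tensorVolumeForm₂_apply (w p q : Fin 4 → ℝ) (v : Fin 3 → Fin 4 → ℝ) :
    tensorVolumeForm₂ w p q v =
      (w ⬝ᵥ v 0) * det (of (Fin.cons p (Fin.cons q (Fin.tail v)) : Fin 4 → Fin 4 → ℝ)) := by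
  rw [tensorVolumeForm₂, LinearMap.uncurryLeft_apply, LinearMap.smulRight_apply,
    _root_.smul_apply, MultilinearMap.curryLeft_apply, volumeForm₁_apply]
  rfl

theorem det_of_mulVec_rows (R : Matrix (Fin 4) (Fin 4) ℝ) (v : Fin 4 → Fin 4 → ℝ) :
    det (of fun i => R *ᵥ v i) = R.det * det (of v) := by
  rw [← det_transpose R, mul_comm, ← det_mul]
  congr 1
  ext i k
  simp [mul_apply, mulVec, dotProduct, mul_comm]

theorem volumeForm₁_mulVec (R : Matrix (Fin 4) (Fin 4) ℝ) (w : Fin 4 → ℝ)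
    (v : Fin 3 → Fin 4 → ℝ) :
    volumeForm₁ (R *ᵥ w) (fun j => R *ᵥ v j) = R.det * volumeForm₁ w v := by
  rw [volumeForm₁_apply, volumeForm₁_apply, ← det_of_mulVec_rows]
  congr 2
  ext i : 1
  induction i using Fin.cases with
  | zero => simp
  | succ j => simp

theorem tensorVolumeForm₂_mulVec {R : Matrix (Fin 4) (Fin 4) ℝ}
    (hR : R ∈ orthogonalGroup (Fin 4) ℝ) (w p q : Fin 4 → ℝ) (v : Fin 3 → Fin 4 → ℝ) :
    tensorVolumeForm₂ (R *ᵥ w) (R *ᵥ p) (R *ᵥ q) (fun j => R *ᵥ v j) =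
      R.det * tensorVolumeForm₂ w p q v := by
  have h : Rᵀ * R = 1 := (mem_orthogonalGroup_iff' _ _).1 hR
  have h1 : (R *ᵥ w) ⬝ᵥ (R *ᵥ v 0) = w ⬝ᵥ v 0 := by
    rw [dotProduct_mulVec, vecMul_mulVec, h, vecMul_one]
  have h2 : (Fin.cons (R *ᵥ p) (Fin.cons (R *ᵥ q) (Fin.tail fun j => R *ᵥ v j)) :
      Fin 4 → Fin 4 → ℝ) = fun i => R *ᵥ
        (Fin.cons p (Fin.cons q (Fin.tail v)) : Fin 4 → Fin 4 → ℝ) i := by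
    ext i : 1
    induction i using Fin.cases with
    | zero => simp
    | succ j =>
      induction j using Fin.cases with
      | zero => simp
      | succ k => simp [Fin.tail]
  rw [tensorVolumeForm₂_apply, tensorVolumeForm₂_apply, h1, h2, det_of_mulVec_rows,
    mul_left_comm]

theorem volumeForm₁_eq_sum (w : Fin 4 → ℝ) (v : Fin 3 → Fin 4 → ℝ) :
    volumeForm₁ w v = ∑ τ, w τ * volumeForm₁ (Pi.single τ 1) v := by
  have h := LinearMap.pi_apply_eq_sum_univ
    ((detRowAlternating (n := Fin 4) (R := ℝ)).toMultilinearMap.curryLeft) w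
  have h1 := congrArg (fun f : MultilinearMap ℝ (fun _ : Fin 3 => Fin 4 → ℝ) ℝ => f v) h
  simp only [_root_.sum_apply, _root_.smul_apply, smul_eq_mul] at h1
  refine h1.trans (Finset.sum_congr rfl fun τ _ => ?_)
  rw [volumeForm₁, show (fun j => if τ = j then (1 : ℝ) else 0) = Pi.single τ 1 by
    ext j; simp [Pi.single_apply, eq_comm]]

theorem leviCivita_eq_det_cons (α β γ δ : Fin 4) :
    leviCivita α β γ δ = volumeForm₁ (Pi.single α 1)
      ![Pi.single β 1, Pi.single γ 1, Pi.single δ 1] := by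
  rw [volumeForm₁_apply, leviCivita]
  congr 1
  ext i k
  fin_cases i <;> simp [one_apply, Pi.single_apply, eq_comm (b := k)]

theorem volumeForm₁_single (w : Fin 4 → ℝ) (m : Fin 3 → Fin 4) :
    volumeForm₁ w (fun j => Pi.single (m j) 1) =
      ∑ τ, w τ * leviCivita τ (m 0) (m 1) (m 2) := by
  rw [volumeForm₁_eq_sum]
  refine Finset.sum_congr rfl fun τ _ => ?_
  rw [leviCivita_eq_det_cons]
  congr 2
  ext i : 1
  fin_cases i <;> rfl

theorem tensorVolumeForm₂_single (w p q : Momentum) (m : Fin 3 → Fin 4) :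
    tensorVolumeForm₂ w p q (fun j => Pi.single (m j) 1) =
      w (m 0) * leviCivitaContract p q (m 1) (m 2) := by
  have h : (Fin.cons p.ofLp (Fin.cons q.ofLp (Fin.tail fun j : Fin 3 => (Pi.single (m j) 1 : Fin 4 → ℝ))) :
      Fin 4 → Fin 4 → ℝ) =
      Fin.cons p.ofLp ![q.ofLp, Pi.single (m 1) 1, Pi.single (m 2) 1] := by
    ext i : 1
    fin_cases i <;> rfl
  have hq : ∀ α, volumeForm₁ (Pi.single α 1) ![q.ofLp, Pi.single (m 1) 1, Pi.single (m 2) 1] =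
      ∑ β, q β * leviCivita α β (m 1) (m 2) := by
    intro α
    have hs : ∀ u : Fin 4 → ℝ,
        volumeForm₁ (Pi.single α 1) ![u, Pi.single (m 1) 1, Pi.single (m 2) 1] =
        -volumeForm₁ u ![Pi.single α 1, Pi.single (m 1) 1, Pi.single (m 2) 1] := by
      intro u
      have h1 := det_permute (Equiv.swap (0 : Fin 4) 1)
        (of (Fin.cons u ![Pi.single α 1, Pi.single (m 1) 1, Pi.single (m 2) (1 : ℝ)]))
      rw [Equiv.Perm.sign_swap (by decide)] at h1
      rw [volumeForm₁_apply, volumeForm₁_apply, ← neg_one_mul]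
      refine Eq.trans ?_ (h1.trans (by simp))
      congr 1
      ext i : 1
      fin_cases i <;> rfl
    rw [hs, volumeForm₁_eq_sum, ← Finset.sum_neg_distrib]
    refine Finset.sum_congr rfl fun β _ => ?_
    rw [leviCivita_eq_det_cons, hs, mul_neg]
  rw [tensorVolumeForm₂_apply, h, ← volumeForm₁_apply, volumeForm₁_eq_sum, leviCivitaContract]
  simp only [hq, dotProduct_single_one, Finset.mul_sum]
  congr 1
  ext α
  congr 1
  ext β
  ring

/-! ### Covariance calculus and invariant contractions -/

section

variable {𝕜 : Type*} [RCLike 𝕜]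

/-- A vector-valued function of the momenta that is `O(4)`-equivariant. -/
def IsEquivariantMomentum (w : conservedTriples → Momentum) : Prop :=
  ∀ R ∈ orthogonalGroup (Fin 4) ℝ, ∀ p, w (rotateMomenta R p) = toEuclideanLin R (w p)

/-- The tensor `ε_{τ μνρ} w^τ`. -/
noncomputable def volumeTensor (w : Momentum) : ThreeTensor ℝ :=
  fun m => ∑ τ, w τ * leviCivita τ (m 0) (m 1) (m 2)

/-- The tensor `w_μ ε_{αβνρ} p^α q^β`. -/
noncomputable def tensorVolume (w p q : Momentum) : ThreeTensor ℝ :=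
  fun m => w (m 0) * leviCivitaContract p q (m 1) (m 2)

theorem isAxialCovariant_volumeTensor {w : conservedTriples → Momentum}
    (hw : IsEquivariantMomentum w) : IsAxialCovariant (𝕜 := ℝ) fun p => volumeTensor (w p) := by
  have h := isAxialCovariant_of_multilinear (fun p => volumeForm₁ (w p).ofLp) (by
    intro R hR p v
    rw [hw R hR]
    exact volumeForm₁_mulVec R _ v)
  simp only [volumeForm₁_single] at h
  exact h

theorem isAxialCovariant_tensorVolume {w p' q' : conservedTriples → Momentum}
    (hw : IsEquivariantMomentum w) (hp : IsEquivariantMomentum p') (hq : IsEquivariantMomentum q') :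
    IsAxialCovariant (𝕜 := ℝ) fun p => tensorVolume (w p) (p' p) (q' p) := by
  have h := isAxialCovariant_of_multilinear
    (fun p => tensorVolumeForm₂ (w p).ofLp (p' p).ofLp (q' p).ofLp) (by
    intro R hR p v
    rw [hw R hR, hp R hR, hq R hR]
    exact tensorVolumeForm₂_mulVec hR _ _ _ v)
  simp only [tensorVolumeForm₂_single] at h
  exact h

theorem IsAxialCovariant.add {Γ Γ' : conservedTriples → ThreeTensor 𝕜} (h : IsAxialCovariant Γ)
    (h' : IsAxialCovariant Γ') : IsAxialCovariant (Γ + Γ') := by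
  intro R hR p m
  simp only [Pi.add_apply, h R hR, h' R hR, mul_add, Finset.sum_add_distrib]

theorem IsAxialCovariant.sub {Γ Γ' : conservedTriples → ThreeTensor 𝕜} (h : IsAxialCovariant Γ)
    (h' : IsAxialCovariant Γ') : IsAxialCovariant (Γ - Γ') := by
  intro R hR p m
  simp only [Pi.sub_apply, h R hR, h' R hR, mul_sub, Finset.sum_sub_distrib]

/-- The product of an invariant scalar with a real covariant tensor is covariant. -/
theorem IsAxialCovariant.invariant_mul {U : conservedTriples → ThreeTensor ℝ}
    (hU : IsAxialCovariant U) {f : conservedTriples → 𝕜}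
    (hf : ∀ R ∈ orthogonalGroup (Fin 4) ℝ, ∀ p, f (rotateMomenta R p) = f p) :
    IsAxialCovariant fun p m => f p * ((U p m : ℝ) : 𝕜) := by
  intro R hR p m
  simp only [hf R hR, hU R hR, RCLike.ofReal_sum, Finset.mul_sum]
  refine Finset.sum_congr rfl fun n _ => ?_
  simp only [RCLike.ofReal_real_eq_id, id, RCLike.ofReal_mul]
  ring

theorem IsAxialCovariant.comp_perm {Γ : conservedTriples → ThreeTensor 𝕜}
    (h : IsAxialCovariant Γ) (σ : Equiv.Perm (Fin 3)) :
    IsAxialCovariant fun p m => Γ p fun i => m (σ i) := by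
  intro R hR p m
  beta_reduce
  rw [h R hR]
  refine (Equiv.sum_comp (σ.arrowCongr (Equiv.refl (Fin 4))).symm _).symm.trans ?_
  refine Finset.sum_congr rfl fun n _ => ?_
  congr 2
  exact Equiv.prod_comp σ fun j => R.det * R (m j) (n j)

/-- The full contraction of a tensor with a real tensor. -/
noncomputable def contract (T : ThreeTensor 𝕜) (U : ThreeTensor ℝ) : 𝕜 :=
  ∑ m, T m * ((U m : ℝ) : 𝕜)

theorem sum_prod_rotate {R : Matrix (Fin 4) (Fin 4) ℝ} (hR : R ∈ orthogonalGroup (Fin 4) ℝ)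
    (n n' : Fin 3 → Fin 4) :
    ∑ m : Fin 3 → Fin 4, (∏ j, (R.det * R (m j) (n j))) * ∏ j, (R.det * R (m j) (n' j)) =
      if n = n' then 1 else 0 := by
  have hd := det_sq_of_mem_orthogonalGroup hR
  have hR' : ∀ a b, ∑ k, R k a * R k b = if a = b then 1 else 0 := by
    intro a b
    have := congrFun (congrFun ((mem_orthogonalGroup_iff' _ _).1 hR) a) b
    simpa [mul_apply, one_apply] using this
  have h : ∀ m : Fin 3 → Fin 4, (∏ j, (R.det * R (m j) (n j))) * ∏ j, (R.det * R (m j) (n' j)) =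
      ∏ j, (R (m j) (n j) * R (m j) (n' j)) := by
    intro m
    rw [← Finset.prod_mul_distrib]
    refine Finset.prod_congr rfl fun j _ => ?_
    linear_combination (R (m j) (n j) * R (m j) (n' j)) * hd
  simp only [h]
  have hs := Finset.prod_univ_sum (fun _ : Fin 3 => (Finset.univ : Finset (Fin 4)))
    fun j k => R k (n j) * R k (n' j)
  rw [Fintype.piFinset_univ] at hs
  simp only [← hs, hR', Finset.prod_ite_zero, Finset.mem_univ, forall_const, Finset.prod_const_one,
    funext_iff]

/-- Both tensors transform with the same orthogonal matrix `(det R)³ R ⊗ R ⊗ R`, so their full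
contraction is an invariant. -/
theorem contract_rotate {Γ : conservedTriples → ThreeTensor 𝕜} (hΓ : IsAxialCovariant Γ)
    {U : conservedTriples → ThreeTensor ℝ} (hU : IsAxialCovariant U)
    {R : Matrix (Fin 4) (Fin 4) ℝ} (hR : R ∈ orthogonalGroup (Fin 4) ℝ) (p : conservedTriples) :
    contract (Γ (rotateMomenta R p)) (U (rotateMomenta R p)) = contract (Γ p) (U p) := by
  have h : ∀ n n' : Fin 3 → Fin 4, ∑ m : Fin 3 → Fin 4, ((∏ j, (R.det * R (m j) (n j)) : ℝ) : 𝕜) *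
      ((∏ j, (R.det * R (m j) (n' j)) : ℝ) : 𝕜) = if n = n' then 1 else 0 := by
    intro n n'
    simp only [← RCLike.ofReal_mul]
    rw [← RCLike.ofReal_sum, sum_prod_rotate hR]
    split_ifs <;> simp
  calc contract (Γ (rotateMomenta R p)) (U (rotateMomenta R p))
      = ∑ m : Fin 3 → Fin 4, ∑ n : Fin 3 → Fin 4, ∑ n' : Fin 3 → Fin 4, Γ p n * ((U p n' : ℝ) : 𝕜) *
        (((∏ j, (R.det * R (m j) (n j)) : ℝ) : 𝕜) *
          ((∏ j, (R.det * R (m j) (n' j)) : ℝ) : 𝕜)) := by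
        refine Finset.sum_congr rfl fun m _ => ?_
        rw [hΓ R hR, hU R hR, RCLike.ofReal_sum, Finset.sum_mul_sum]
        refine Finset.sum_congr rfl fun n _ => Finset.sum_congr rfl fun n' _ => ?_
        simp only [RCLike.ofReal_real_eq_id, id, RCLike.ofReal_mul]
        ring
    _ = ∑ n, ∑ n', Γ p n * ((U p n' : ℝ) : 𝕜) * if n = n' then 1 else 0 := by
        rw [Finset.sum_comm]
        refine Finset.sum_congr rfl fun n _ => ?_
        rw [Finset.sum_comm]
        refine Finset.sum_congr rfl fun n' _ => ?_
        rw [← Finset.mul_sum, h]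
    _ = contract (Γ p) (U p) := by simp [contract]

theorem norm_sq_invariant (i : Fin 3) :
    ∀ R ∈ orthogonalGroup (Fin 4) ℝ, ∀ p, ‖(rotateMomenta R p).1 i‖ ^ 2 = ‖p.1 i‖ ^ 2 :=
  fun _ hR p => by rw [norm_rotateMomenta hR]

theorem isEquivariantMomentum_apply (i : Fin 3) : IsEquivariantMomentum fun p => p.1 i :=
  fun _ _ _ => rfl

theorem IsEquivariantMomentum.sub {w w' : conservedTriples → Momentum}
    (hw : IsEquivariantMomentum w) (hw' : IsEquivariantMomentum w') :
    IsEquivariantMomentum fun p => w p - w' p := by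
  intro R hR p
  simp only [hw R hR, hw' R hR, map_sub]

theorem IsEquivariantMomentum.invariant_smul {w : conservedTriples → Momentum}
    (hw : IsEquivariantMomentum w) {f : conservedTriples → ℝ}
    (hf : ∀ R ∈ orthogonalGroup (Fin 4) ℝ, ∀ p, f (rotateMomenta R p) = f p) :
    IsEquivariantMomentum fun p => f p • w p := by
  intro R hR p
  simp only [hw R hR, hf R hR, map_smul]

/-! ### Antisymmetry, and the covariance and Bose symmetry of the normal form -/

theorem leviCivita_comp_swap (f : Fin 4 → Fin 4) {i j : Fin 4} (hij : i ≠ j) :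
    leviCivita (f (Equiv.swap i j 0)) (f (Equiv.swap i j 1)) (f (Equiv.swap i j 2))
      (f (Equiv.swap i j 3)) = -leviCivita (f 0) (f 1) (f 2) (f 3) := by
  have h := det_permute (Equiv.swap i j) ((1 : Matrix (Fin 4) (Fin 4) ℝ).submatrix f id)
  rw [Equiv.Perm.sign_swap hij] at h
  have hf : ∀ g : Fin 4 → Fin 4, ![g 0, g 1, g 2, g 3] = g := by
    intro g
    ext k
    fin_cases k <;> rfl
  rw [leviCivita, leviCivita, hf f, hf fun k => f (Equiv.swap i j k)]
  refine Eq.trans ?_ (h.trans (by simp))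
  rfl

theorem leviCivita_swap₀₁ (α β γ δ : Fin 4) : leviCivita β α γ δ = -leviCivita α β γ δ :=
  leviCivita_comp_swap ![α, β, γ, δ] (i := 0) (j := 1) (by decide)

theorem leviCivita_swap₁₂ (α β γ δ : Fin 4) : leviCivita α γ β δ = -leviCivita α β γ δ :=
  leviCivita_comp_swap ![α, β, γ, δ] (i := 1) (j := 2) (by decide)

theorem leviCivita_swap₂₃ (α β γ δ : Fin 4) : leviCivita α β δ γ = -leviCivita α β γ δ :=
  leviCivita_comp_swap ![α, β, γ, δ] (i := 2) (j := 3) (by decide)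

theorem leviCivitaContract_swap_indices (p q : Momentum) (μ ν : Fin 4) :
    leviCivitaContract p q ν μ = -leviCivitaContract p q μ ν := by
  simp only [leviCivitaContract, ← Finset.sum_neg_distrib]
  refine Finset.sum_congr rfl fun α _ => Finset.sum_congr rfl fun β _ => ?_
  rw [leviCivita_swap₂₃]
  ring

theorem leviCivitaContract_swap (p q : Momentum) (μ ν : Fin 4) :
    leviCivitaContract q p μ ν = -leviCivitaContract p q μ ν := by
  simp only [leviCivitaContract, ← Finset.sum_neg_distrib]
  rw [Finset.sum_comm]
  refine Finset.sum_congr rfl fun α _ => Finset.sum_congr rfl fun β _ => ?_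
  rw [leviCivita_swap₀₁]
  ring

theorem leviCivitaContract_self (p : Momentum) (μ ν : Fin 4) :
    leviCivitaContract p p μ ν = 0 := by
  linarith [leviCivitaContract_swap p p μ ν]

theorem leviCivitaContract_zero_right (p : Momentum) (μ ν : Fin 4) :
    leviCivitaContract p 0 μ ν = 0 := by
  simp [leviCivitaContract]

theorem leviCivitaContract_add_right (p q q' : Momentum) (μ ν : Fin 4) :
    leviCivitaContract p (q + q') μ ν =
      leviCivitaContract p q μ ν + leviCivitaContract p q' μ ν := by
  simp only [leviCivitaContract, PiLp.add_apply, mul_add, Finset.sum_add_distrib]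

theorem leviCivitaContract_zero_two (p : conservedTriples) (μ ν : Fin 4) :
    leviCivitaContract (p.1 0) (p.1 2) μ ν = -leviCivitaContract (p.1 0) (p.1 1) μ ν := by
  have h := leviCivitaContract_zero_right (p.1 0) μ ν
  rw [← sum_conservedTriples p, leviCivitaContract_add_right, leviCivitaContract_add_right,
    leviCivitaContract_self] at h
  linarith

/-- The tensor-valued function of the momenta given by `axialForm`. -/
noncomputable def axialTensor (A B : ℝ → ℝ → ℝ → 𝕜) (p : conservedTriples) : ThreeTensor 𝕜 :=
  fun m => axialForm A B p (m 0) (m 1) (m 2)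

theorem axialForm_eq (A B : ℝ → ℝ → ℝ → 𝕜) (p : conservedTriples) (μ ν ρ : Fin 4) :
    axialForm A B p μ ν ρ =
      atSquares A p 0 1 2 * ((volumeTensor (p.1 0) ![μ, ν, ρ] : ℝ) : 𝕜)
      - atSquares A p 1 0 2 * ((volumeTensor (p.1 1) ![μ, ν, ρ] : ℝ) : 𝕜)
      + (atSquares B p 0 1 2 * ((p.1 2 ν : ℝ) : 𝕜) + atSquares B p 2 1 0 * ((p.1 0 ν : ℝ) : 𝕜)) *
          ((leviCivitaContract (p.1 0) (p.1 1) ρ μ : ℝ) : 𝕜)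
      + (atSquares B p 2 0 1 * ((p.1 1 μ : ℝ) : 𝕜) + atSquares B p 1 0 2 * ((p.1 2 μ : ℝ) : 𝕜)) *
          ((leviCivitaContract (p.1 0) (p.1 1) ν ρ : ℝ) : 𝕜)
      + (atSquares B p 1 2 0 * ((p.1 0 ρ : ℝ) : 𝕜) + atSquares B p 0 2 1 * ((p.1 1 ρ : ℝ) : 𝕜)) *
          ((leviCivitaContract (p.1 0) (p.1 1) μ ν : ℝ) : 𝕜) := by
  simp only [axialForm, volumeTensor, RCLike.ofReal_sum, RCLike.ofReal_mul, Finset.mul_sum,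
    ← Finset.sum_sub_distrib, Matrix.cons_val]
  congr 3
  refine Finset.sum_congr rfl fun τ _ => ?_
  ring

theorem atSquares_invariant {α : Type*} (F : ℝ → ℝ → ℝ → α) (i j k : Fin 3) :
    ∀ R ∈ orthogonalGroup (Fin 4) ℝ, ∀ p,
      atSquares F (rotateMomenta R p) i j k = atSquares F p i j k := by
  intro R hR p
  simp only [atSquares, norm_rotateMomenta hR]

theorem isAxialCovariant_axialTensor (A B : ℝ → ℝ → ℝ → 𝕜) :
    IsAxialCovariant (axialTensor A B) := by
  have hV : ∀ i, IsAxialCovariant (𝕜 := ℝ) fun p => volumeTensor (p.1 i) := fun i =>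
    isAxialCovariant_volumeTensor (isEquivariantMomentum_apply i)
  have hT : ∀ i (σ : Equiv.Perm (Fin 3)), IsAxialCovariant (𝕜 := ℝ)
      fun p m => tensorVolume (p.1 i) (p.1 0) (p.1 1) fun k => m (σ k) := fun i σ =>
    (isAxialCovariant_tensorVolume (isEquivariantMomentum_apply i) (isEquivariantMomentum_apply 0)
      (isEquivariantMomentum_apply 1)).comp_perm σ
  have hA : ∀ i j k l, IsAxialCovariant fun p m =>
      atSquares A p i j k * ((volumeTensor (p.1 l) m : ℝ) : 𝕜) := fun i j k l =>
    (hV l).invariant_mul (atSquares_invariant A i j k)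
  have hB : ∀ i j k l (σ : Equiv.Perm (Fin 3)), IsAxialCovariant fun p m => atSquares B p i j k *
      ((tensorVolume (p.1 l) (p.1 0) (p.1 1) (fun k => m (σ k)) : ℝ) : 𝕜) := fun i j k l σ =>
    (hT l σ).invariant_mul (atSquares_invariant B i j k)
  -- The cyclic permutations move the free momentum index from slot `ν` or `ρ` to the first slot of
  -- `tensorVolume`.
  have h := (((((((hA 0 1 2 0).sub (hA 1 0 2 1)).add (hB 0 1 2 2 (finRotate 3))).add
    (hB 2 1 0 0 (finRotate 3))).add (hB 2 0 1 1 1)).add (hB 1 0 2 2 1)).add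
    (hB 1 2 0 0 (finRotate 3)⁻¹)).add (hB 0 2 1 1 (finRotate 3)⁻¹)
  convert h using 1
  ext p m
  have hm : ![m 0, m 1, m 2] = m := by
    ext k
    fin_cases k <;> rfl
  rw [axialTensor, axialForm_eq, hm]
  simp only [Pi.add_apply, Pi.sub_apply, tensorVolume, RCLike.ofReal_mul, Equiv.Perm.one_apply,
    show finRotate 3 0 = 1 from rfl, show finRotate 3 1 = 2 from rfl,
    show finRotate 3 2 = 0 from rfl, show (finRotate 3)⁻¹ 0 = 2 from rfl,
    show (finRotate 3)⁻¹ 1 = 0 from rfl, show (finRotate 3)⁻¹ 2 = 1 from rfl]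
  ring

theorem IsBoseSymmetric.sub {Γ Γ' : conservedTriples → ThreeTensor 𝕜} (h : IsBoseSymmetric Γ)
    (h' : IsBoseSymmetric Γ') : IsBoseSymmetric (Γ - Γ') := by
  intro σ p m
  simp only [Pi.sub_apply, h σ, h' σ]

/-- The permutations that preserve `Γ` form a submonoid, and adjacent transpositions generate the
symmetric group. -/
theorem isBoseSymmetric_of_swap {Γ : conservedTriples → ThreeTensor 𝕜}
    (h01 : ∀ p m, Γ (permuteMomenta (Equiv.swap 0 1) p) (fun i => m (Equiv.swap 0 1 i)) = Γ p m)
    (h12 : ∀ p m, Γ (permuteMomenta (Equiv.swap 1 2) p) (fun i => m (Equiv.swap 1 2 i)) = Γ p m) :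
    IsBoseSymmetric Γ := by
  let S : Submonoid (Equiv.Perm (Fin 3)) :=
    { carrier := {σ | ∀ p m, Γ (permuteMomenta σ p) (fun i => m (σ i)) = Γ p m}
      one_mem' := fun p m => rfl
      mul_mem' := fun {σ τ} hσ hτ p m => by
        rw [← hσ p m, ← hτ (permuteMomenta σ p)]
        rfl }
  have hS : S = ⊤ := by
    rw [eq_top_iff, ← Equiv.Perm.mclosure_swap_castSucc_succ, Submonoid.closure_le]
    rintro _ ⟨i, rfl⟩
    fin_cases i
    · exact h01
    · exact h12
  intro σ
  have : σ ∈ S := hS ▸ Submonoid.mem_top σ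
  exact this

theorem volumeTensor_add (w w' : Momentum) (m : Fin 3 → Fin 4) :
    volumeTensor (w + w') m = volumeTensor w m + volumeTensor w' m := by
  simp only [volumeTensor, PiLp.add_apply, add_mul, Finset.sum_add_distrib]

theorem volumeTensor_smul (c : ℝ) (w : Momentum) (m : Fin 3 → Fin 4) :
    volumeTensor (c • w) m = c * volumeTensor w m := by
  simp only [volumeTensor, PiLp.smul_apply, smul_eq_mul, Finset.mul_sum, mul_assoc]

theorem volumeTensor_swap₀₁ (w : Momentum) (μ ν ρ : Fin 4) :
    volumeTensor w ![ν, μ, ρ] = -volumeTensor w ![μ, ν, ρ] := by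
  simp only [volumeTensor, Matrix.cons_val, ← Finset.sum_neg_distrib, ← mul_neg,
    ← leviCivita_swap₁₂]

theorem volumeTensor_swap₁₂ (w : Momentum) (μ ν ρ : Fin 4) :
    volumeTensor w ![μ, ρ, ν] = -volumeTensor w ![μ, ν, ρ] := by
  simp only [volumeTensor, Matrix.cons_val, ← Finset.sum_neg_distrib, ← mul_neg,
    ← leviCivita_swap₂₃]

theorem volumeTensor_two (p : conservedTriples) (m : Fin 3 → Fin 4) :
    volumeTensor (p.1 2) m = -volumeTensor (p.1 0) m - volumeTensor (p.1 1) m := by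
  have h : p.1 2 = (-1 : ℝ) • p.1 0 + (-1 : ℝ) • p.1 1 := by
    rw [← sub_eq_zero, ← sum_conservedTriples p]
    module
  rw [h, volumeTensor_add, volumeTensor_smul, volumeTensor_smul]
  ring

theorem atSquares_permuteMomenta {α : Type*} (F : ℝ → ℝ → ℝ → α) (σ : Equiv.Perm (Fin 3))
    (p : conservedTriples) (i j k : Fin 3) :
    atSquares F (permuteMomenta σ p) i j k = atSquares F p (σ i) (σ j) (σ k) := rfl

/-- The `B` terms are permuted among themselves, and the exchange of the first two legs needs only
antisymmetry of `ε`. The exchange of the last two replaces `p₂` by `p₃`; eliminating `p₃` leaves a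
cyclic sum of `A` as coefficient of `p₁`, which is where the relations for `A` enter. -/
theorem isBoseSymmetric_axialTensor {A : ℝ → ℝ → ℝ → 𝕜} (hA : HasBoseRelations A)
    (B : ℝ → ℝ → ℝ → 𝕜) : IsBoseSymmetric (axialTensor A B) := by
  refine isBoseSymmetric_of_swap (fun p m => ?_) (fun p m => ?_)
  · simp only [axialTensor, axialForm_eq, atSquares_permuteMomenta, permuteMomenta_apply,
      Equiv.swap_apply_left, Equiv.swap_apply_right,
      show Equiv.swap (0 : Fin 3) 1 2 = 2 from rfl]
    rw [volumeTensor_swap₀₁ _ (m 0), volumeTensor_swap₀₁ _ (m 0), leviCivitaContract_swap,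
      leviCivitaContract_swap_indices _ _ (m 1) (m 2),
      leviCivitaContract_swap (p.1 0), leviCivitaContract_swap_indices _ _ (m 2) (m 0),
      leviCivitaContract_swap (p.1 0), leviCivitaContract_swap_indices _ _ (m 0) (m 1)]
    push_cast
    ring
  · have h1 : atSquares A p 0 2 1 + atSquares A p 2 1 0 + atSquares A p 1 0 2 = 0 := hA.2 _ _ _
    have h2 : atSquares A p 2 0 1 = atSquares A p 1 0 2 := hA.1 _ _ _
    have h3 : atSquares A p 2 1 0 = atSquares A p 0 1 2 := hA.1 _ _ _
    simp only [axialTensor, axialForm_eq, atSquares_permuteMomenta, permuteMomenta_apply,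
      Equiv.swap_apply_left, Equiv.swap_apply_right,
      show Equiv.swap (1 : Fin 3) 2 0 = 0 from rfl]
    simp only [leviCivitaContract_zero_two]
    rw [volumeTensor_swap₁₂ _ _ (m 1), volumeTensor_swap₁₂ _ _ (m 1),
      leviCivitaContract_swap_indices _ _ (m 1) (m 2),
      leviCivitaContract_swap_indices _ _ (m 2) (m 0),
      leviCivitaContract_swap_indices _ _ (m 0) (m 1), volumeTensor_two, h2]
    rw [h3] at h1
    push_cast
    linear_combination (-((volumeTensor (p.1 0) ![m 0, m 1, m 2] : ℝ) : 𝕜)) * h1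

theorem axialTensor_add (A B : ℝ → ℝ → ℝ → 𝕜) :
    axialTensor A 0 + axialTensor 0 B = axialTensor A B := by
  ext p m
  simp [axialTensor, axialForm_eq, atSquares]
  ring

/-! ### Sign rules from reflections and coordinate transpositions -/

theorem diagonal_mem_orthogonalGroup {s : Fin 4 → ℝ} (hs : ∀ i, s i * s i = 1) :
    diagonal s ∈ orthogonalGroup (Fin 4) ℝ := by
  rw [mem_orthogonalGroup_iff, diagonal_transpose, diagonal_mul_diagonal]
  simp [hs]

/-- The action of a diagonal reflection. -/
theorem IsAxialCovariant.diagonal_apply {Γ : conservedTriples → ThreeTensor 𝕜}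
    (h : IsAxialCovariant Γ) {s : Fin 4 → ℝ} (hs : ∀ i, s i * s i = 1) (p : conservedTriples)
    (m : Fin 3 → Fin 4) :
    Γ (rotateMomenta (diagonal s) p) m = (((∏ i, s i) * ∏ j, s (m j) : ℝ) : 𝕜) * Γ p m := by
  rw [h _ (diagonal_mem_orthogonalGroup hs), Finset.sum_eq_single m]
  · congr 2
    have hd := det_sq_of_mem_orthogonalGroup (diagonal_mem_orthogonalGroup hs)
    rw [Finset.prod_mul_distrib, Finset.prod_const, Finset.card_univ, Fintype.card_fin, pow_succ,
      hd, one_mul, det_diagonal]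
    simp
  · intro n _ hn
    obtain ⟨j, hj⟩ := Function.ne_iff.1 hn
    rw [Finset.prod_eq_zero (Finset.mem_univ j) (by rw [diagonal_apply_ne' _ hj, mul_zero])]
    simp
  · simp

/-- The reflection of axis `k` fixes the momenta and has determinant `-1`; if `k` occurs an even
number of times among the indices, the component equals its own negative. -/
theorem IsAxialCovariant.eq_zero_of_even {Γ : conservedTriples → ThreeTensor 𝕜}
    (h : IsAxialCovariant Γ) {p : conservedTriples} {k : Fin 4} (hp : ∀ i, p.1 i k = 0)
    {m : Fin 3 → Fin 4} (hm : ∏ j, (if m j = k then (-1 : ℤ) else 1) = 1) : Γ p m = 0 := by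
  let s : Fin 4 → ℝ := fun i => if i = k then -1 else 1
  have hs : ∀ i, s i * s i = 1 := fun i => by dsimp only [s]; split_ifs <;> norm_num
  have hpr : rotateMomenta (diagonal s) p = p := by
    ext i l
    rw [rotateMomenta_coord, Finset.sum_eq_single l]
    · by_cases hl : l = k
      · simp [hl, hp]
      · simp [s, hl]
    · intro l' _ hl'
      rw [diagonal_apply_ne' _ hl', zero_mul]
    · simp
  have h1 := h.diagonal_apply hs p m
  have h2 : ∏ i, s i = -1 := by simp [s]
  have h3 : ∏ j, s (m j) = 1 := by
    have := congrArg (fun z : ℤ => (z : ℝ)) hm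
    push_cast at this
    exact this
  rw [hpr, h2, h3] at h1
  have h4 : (2 : 𝕜) * Γ p m = 0 := by
    push_cast at h1
    linear_combination h1
  simpa using h4

theorem permMatrix_mem_orthogonalGroup (σ : Equiv.Perm (Fin 4)) :
    σ.permMatrix ℝ ∈ orthogonalGroup (Fin 4) ℝ := by
  rw [mem_orthogonalGroup_iff, transpose_permMatrix, ← permMatrix_mul]
  simp

/-- Exchanging two axes orthogonal to all momenta fixes them, and the sign is the determinant of the
transposition, cubed. -/
theorem IsAxialCovariant.comp_swap_indices {Γ : conservedTriples → ThreeTensor 𝕜}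
    (h : IsAxialCovariant Γ) {p : conservedTriples} {k l : Fin 4} (hkl : k ≠ l)
    (hk : ∀ i, p.1 i k = 0) (hl : ∀ i, p.1 i l = 0) (m : Fin 3 → Fin 4) :
    Γ p (fun j => Equiv.swap k l (m j)) = -Γ p m := by
  set σ := Equiv.swap k l with hσ
  have hR := permMatrix_mem_orthogonalGroup σ
  have hpr : rotateMomenta (σ.permMatrix ℝ) p = p := by
    ext i a
    have h1 : (rotateMomenta (σ.permMatrix ℝ) p).1 i a = p.1 i (σ a) :=
      congrFun (permMatrix_mulVec σ (v := (p.1 i).ofLp)) a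
    rw [h1]
    rcases eq_or_ne a k with rfl | hak
    · rw [hσ, Equiv.swap_apply_left, hk, hl]
    · rcases eq_or_ne a l with rfl | hal
      · rw [hσ, Equiv.swap_apply_right, hk, hl]
      · rw [hσ, Equiv.swap_apply_of_ne_of_ne hak hal]
  have hdet : (σ.permMatrix ℝ).det = -1 := by
    rw [det_permutation, hσ, Equiv.Perm.sign_swap hkl]
    simp
  have h1 := h _ hR p m
  rw [hpr, Finset.sum_eq_single (fun j => σ (m j))] at h1
  · rw [h1, hdet]
    simp [Equiv.Perm.permMatrix, PEquiv.toMatrix_apply, Odd.neg_one_pow (show Odd 3 by decide)]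
  · intro n _ hn
    obtain ⟨j, hj⟩ := Function.ne_iff.1 hn
    have : σ.permMatrix ℝ (m j) (n j) = 0 := by
      simp [Equiv.Perm.permMatrix, PEquiv.toMatrix_apply, Ne.symm hj]
    rw [Finset.prod_eq_zero (Finset.mem_univ j) (by rw [this, mul_zero])]
    simp
  · simp

theorem IsAxialCovariant.apply_zero {Γ : conservedTriples → ThreeTensor 𝕜}
    (h : IsAxialCovariant Γ) : Γ 0 = 0 := by
  ext m
  have h1 := h.diagonal_apply (s := fun _ => -1) (by norm_num) 0 m
  have h0 : rotateMomenta (diagonal fun _ => -1) 0 = 0 := by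
    ext i a
    simp [rotateMomenta_coord]
  rw [h0] at h1
  have h4 : (2 : 𝕜) * Γ 0 m = 0 := by
    norm_num at h1
    linear_combination h1
  simpa using h4

theorem IsAxialCovariant.eq_zero_of_rotate {Γ : conservedTriples → ThreeTensor 𝕜}
    (h : IsAxialCovariant Γ) {R : Matrix (Fin 4) (Fin 4) ℝ} (hR : R ∈ orthogonalGroup (Fin 4) ℝ)
    {p : conservedTriples} (h0 : Γ (rotateMomenta R p) = 0) : Γ p = 0 := by
  have hR' : Rᵀ ∈ orthogonalGroup (Fin 4) ℝ := by
    rw [mem_orthogonalGroup_iff, transpose_transpose]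
    exact (mem_orthogonalGroup_iff' _ _).1 hR
  have h1 : p = rotateMomenta Rᵀ (rotateMomenta R p) := by
    rw [rotateMomenta_mul, (mem_orthogonalGroup_iff' _ _).1 hR, rotateMomenta_one]
  ext m
  rw [h1, h _ hR', h0]
  simp

/-- A covariant tensor at momenta along the first axis vanishes if one component does. -/
theorem IsAxialCovariant.eq_zero_of_axis {Γ : conservedTriples → ThreeTensor 𝕜}
    (h : IsAxialCovariant Γ) {p : conservedTriples} (hp : ∀ i k, k ≠ 0 → p.1 i k = 0)
    (h0 : Γ p ![1, 2, 3] = 0) : Γ p = 0 := by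
  have hs : ∀ k l, k ≠ l → k ≠ 0 → l ≠ 0 → ∀ m, Γ p m = 0 →
      Γ p (fun j => Equiv.swap k l (m j)) = 0 := fun k l hkl hk hl m hm => by
    rw [h.comp_swap_indices hkl (fun i => hp i k hk) (fun i => hp i l hl), hm, neg_zero]
  have h12 := hs 1 2 (by decide) (by decide) (by decide)
  have h23 := hs 2 3 (by decide) (by decide) (by decide)
  -- A surviving component contains each of `1, 2, 3` an odd number of times, so its indices are a
  -- permutation of them.
  have key : ∀ m : Fin 3 → Fin 4,
      (∃ k : Fin 4, k ≠ 0 ∧ ∏ j, (if m j = k then (-1 : ℤ) else 1) = 1) ∨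
      m = ![1, 2, 3] ∨ m = ![2, 1, 3] ∨ m = ![1, 3, 2] ∨ m = ![2, 3, 1] ∨ m = ![3, 1, 2] ∨
        m = ![3, 2, 1] := by decide
  have e : ∀ {m m' : Fin 3 → Fin 4}, (∀ j, m j = m' j) → Γ p m = 0 → Γ p m' = 0 :=
    fun hm h => funext hm ▸ h
  have h213 : Γ p ![2, 1, 3] = 0 := e (by decide) (h12 _ h0)
  have h132 : Γ p ![1, 3, 2] = 0 := e (by decide) (h23 _ h0)
  have h312 : Γ p ![3, 1, 2] = 0 := e (by decide) (h23 _ h213)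
  have h231 : Γ p ![2, 3, 1] = 0 := e (by decide) (h12 _ h132)
  have h321 : Γ p ![3, 2, 1] = 0 := e (by decide) (h12 _ h312)
  ext m
  rcases key m with ⟨k, hk, hm⟩ | rfl | rfl | rfl | rfl | rfl | rfl
  · exact h.eq_zero_of_even (fun i => hp i k hk) hm
  all_goals assumption

/-- A covariant tensor at momenta in the plane of the first two axes vanishes if six of its
components do. -/
theorem IsAxialCovariant.eq_zero_of_planar {Γ : conservedTriples → ThreeTensor 𝕜}
    (h : IsAxialCovariant Γ) {p : conservedTriples} (hp : ∀ i, p.1 i 2 = 0 ∧ p.1 i 3 = 0)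
    (h0 : ∀ i : Fin 4, i = 0 ∨ i = 1 →
      Γ p ![i, 2, 3] = 0 ∧ Γ p ![2, i, 3] = 0 ∧ Γ p ![2, 3, i] = 0) : Γ p = 0 := by
  have hs := h.comp_swap_indices (k := 2) (l := 3) (by decide) (fun i => (hp i).1)
    (fun i => (hp i).2)
  -- A surviving component contains `2` and `3` exactly once each, and its remaining index is `0` or
  -- `1`.
  have key : ∀ m : Fin 3 → Fin 4,
      ∏ j, (if m j = 2 then (-1 : ℤ) else 1) = 1 ∨ ∏ j, (if m j = 3 then (-1 : ℤ) else 1) = 1 ∨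
      ∃ i : Fin 4, (i = 0 ∨ i = 1) ∧ ∃ k : Fin 3,
        (m = ![![i, 2, 3], ![2, i, 3], ![2, 3, i]] k ∨
         m = fun j => Equiv.swap 2 3 (![![i, 2, 3], ![2, i, 3], ![2, 3, i]] k j)) := by decide
  ext m
  rcases key m with hm | hm | ⟨i, hi, k, hm⟩
  · exact h.eq_zero_of_even (fun i => (hp i).1) hm
  · exact h.eq_zero_of_even (fun i => (hp i).2) hm
  · have h1 : Γ p (![![i, 2, 3], ![2, i, 3], ![2, 3, i]] k) = 0 := by
      obtain ⟨ha, hb, hc⟩ := h0 i hi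
      fin_cases k
      exacts [ha, hb, hc]
    rcases hm with rfl | rfl
    · exact h1
    · rw [hs, h1, neg_zero]
      rfl

/-! ### Collinear momenta and the function `A` -/

/-- The momenta are multiples of one vector. -/
def IsCollinear (p : conservedTriples) : Prop :=
  ∃ v : Momentum, ∀ i, ∃ c : ℝ, p.1 i = c • v

theorem IsCollinear.exists_rotate {p : conservedTriples} (hp : IsCollinear p) :
    ∃ R ∈ orthogonalGroup (Fin 4) ℝ, ∀ i k, k ≠ 0 → (rotateMomenta R p).1 i k = 0 := by
  obtain ⟨v, hv⟩ := hp
  obtain ⟨R, hR, hRv⟩ := exists_orthogonal_of_norm_linearMap_eq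
    (LinearMap.toSpanSingleton ℝ Momentum v)
    (LinearMap.toSpanSingleton ℝ Momentum (EuclideanSpace.single 0 ‖v‖)) (by simp [norm_smul])
  refine ⟨R, hR, fun i k hk => ?_⟩
  obtain ⟨c, hc⟩ := hv i
  have h1 := hRv c
  simp only [LinearMap.toSpanSingleton_apply] at h1
  rw [rotateMomenta_apply, hc, h1]
  simp [hk]

theorem leviCivita_zero_one_two_three : leviCivita 0 1 2 3 = 1 := by
  have h : (1 : Matrix (Fin 4) (Fin 4) ℝ).submatrix ![0, 1, 2, 3] id = 1 := by
    ext i j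
    fin_cases i <;> rfl
  rw [leviCivita, h, det_one]

theorem volumeTensor_of_axis {w : Momentum} (hw : ∀ k, k ≠ 0 → w k = 0) (m : Fin 3 → Fin 4) :
    volumeTensor w m = w 0 * leviCivita 0 (m 0) (m 1) (m 2) := by
  rw [volumeTensor, Finset.sum_eq_single 0]
  · intro k _ hk
    rw [hw k hk, zero_mul]
  · simp

theorem norm_sq_of_axis {w : Momentum} (hw : ∀ k, k ≠ 0 → w k = 0) : ‖w‖ ^ 2 = w 0 ^ 2 := by
  rw [EuclideanSpace.norm_sq_eq, Finset.sum_eq_single 0]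
  · simp
  · intro k _ hk
    rw [hw k hk]
    simp
  · simp

/-- Away from zero some momentum `p_i` is nonzero, and subtracting a suitable multiple of `ε(p_i, ·,
·, ·)` removes the only independent component. -/
theorem IsAxialCovariant.eq_leviCivita_of_axis {Γ : conservedTriples → ThreeTensor 𝕜}
    (h : IsAxialCovariant Γ) {p : conservedTriples} (hp : ∀ i k, k ≠ 0 → p.1 i k = 0)
    (m : Fin 3 → Fin 4) :
    Γ p m = Γ p ![1, 2, 3] * ((leviCivita 0 (m 0) (m 1) (m 2) : ℝ) : 𝕜) := by
  by_cases hp0 : p = 0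
  · simp [hp0, h.apply_zero]
  obtain ⟨i, hi⟩ : ∃ i, p.1 i 0 ≠ 0 := by
    by_contra! hc
    refine hp0 (Subtype.ext (funext fun i => ?_))
    ext k
    by_cases hk : k = 0
    · rw [hk, hc]; rfl
    · rw [hp i k hk]; rfl
  have hV := (isAxialCovariant_volumeTensor (isEquivariantMomentum_apply i)).invariant_mul
    (f := fun _ => Γ p ![1, 2, 3] / ((p.1 i 0 : ℝ) : 𝕜)) (fun _ _ _ => rfl)
  have hi' : ((p.1 i 0 : ℝ) : 𝕜) ≠ 0 := RCLike.ofReal_ne_zero.2 hi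
  have h1 := (h.sub hV).eq_zero_of_axis hp (by
    simp only [Pi.sub_apply, volumeTensor_of_axis (hp i)]
    simp only [Matrix.cons_val, leviCivita_zero_one_two_three, mul_one]
    rw [div_mul_cancel₀ _ hi', sub_self])
  have h2 := congrFun h1 m
  simp only [Pi.sub_apply, volumeTensor_of_axis (hp i), Pi.zero_apply, sub_eq_zero] at h2
  rw [h2, RCLike.ofReal_mul, ← mul_assoc, div_mul_cancel₀ _ hi']

theorem contract_permuteMomenta {Γ : conservedTriples → ThreeTensor 𝕜} (h : IsBoseSymmetric Γ)
    (σ : Equiv.Perm (Fin 3)) (p : conservedTriples) (U : ThreeTensor ℝ) :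
    contract (Γ (permuteMomenta σ p)) U = contract (Γ p) fun m => U fun i => m (σ i) := by
  rw [contract, contract]
  refine (Equiv.sum_comp (σ.arrowCongr (Equiv.refl (Fin 4))).symm _).symm.trans ?_
  refine Finset.sum_congr rfl fun m _ => ?_
  rw [← h σ p m]
  rfl

theorem volumeTensor_comp_finRotate (w : Momentum) (m : Fin 3 → Fin 4) :
    volumeTensor w (fun i => m (finRotate 3 i)) = volumeTensor w m := by
  have e : ∀ g : Fin 3 → Fin 4, g = ![g 0, g 1, g 2] := by
    intro g
    ext k
    fin_cases k <;> rfl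
  rw [e m, e fun i => _]
  change volumeTensor w ![m 1, m 2, m 0] = _
  rw [volumeTensor_swap₁₂, volumeTensor_swap₀₁, neg_neg]

theorem volumeTensor_comp_swap (w : Momentum) (m : Fin 3 → Fin 4) :
    volumeTensor w (fun i => m (Equiv.swap 1 2 i)) = -volumeTensor w m := by
  have e : ∀ g : Fin 3 → Fin 4, g = ![g 0, g 1, g 2] := by
    intro g
    ext k
    fin_cases k <;> rfl
  rw [e m, e fun i => _]
  exact volumeTensor_swap₁₂ _ _ _ _

theorem contract_add_right (T : ThreeTensor 𝕜) (U U' : ThreeTensor ℝ) :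
    contract T (U + U') = contract T U + contract T U' := by
  simp [contract, mul_add, Finset.sum_add_distrib]

/-- The totally antisymmetric part of an amplitude, in terms of an invariant function. -/
theorem exists_invariant_volume {Γ : conservedTriples → ThreeTensor 𝕜}
    (hcov : IsAxialCovariant Γ) (hbose : IsBoseSymmetric Γ) :
    ∃ F : ℝ → ℝ → ℝ → 𝕜,
      (∀ p, atSquares F p 0 1 2 = contract (Γ p) (volumeTensor (p.1 1 - p.1 2))) ∧
      (∀ x y z, F x z y = F x y z) ∧ ∀ x y z, F x y z + F y z x + F z x y = 0 := by
  obtain ⟨F, hF, hF0⟩ := exists_eq_norm_sq_of_invariant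
    (fun p => contract (Γ p) (volumeTensor (p.1 1 - p.1 2))) (fun R hR p => contract_rotate hcov
      (isAxialCovariant_volumeTensor
        ((isEquivariantMomentum_apply 1).sub (isEquivariantMomentum_apply 2))) hR p)
  -- A cyclic permutation is even, so it permutes the momenta in the contraction without a sign. The
  -- three contractions then involve differences that telescope to zero.
  have hrot : ∀ p, F (‖p.1 1‖ ^ 2) (‖p.1 2‖ ^ 2) (‖p.1 0‖ ^ 2) =
      contract (Γ p) (volumeTensor (p.1 2 - p.1 0)) := by
    intro p
    have h1 := hF (permuteMomenta (finRotate 3) p)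
    rw [contract_permuteMomenta hbose] at h1
    simp only [volumeTensor_comp_finRotate] at h1
    exact h1
  have hrot' : ∀ p, F (‖p.1 2‖ ^ 2) (‖p.1 0‖ ^ 2) (‖p.1 1‖ ^ 2) =
      contract (Γ p) (volumeTensor (p.1 0 - p.1 1)) := by
    intro p
    have h1 := hrot (permuteMomenta (finRotate 3) p)
    rw [contract_permuteMomenta hbose] at h1
    simp only [volumeTensor_comp_finRotate] at h1
    exact h1
  refine ⟨F, hF, fun x y z => ?_, fun x y z => ?_⟩
  · by_cases h : ∃ p : conservedTriples, ‖p.1 0‖ ^ 2 = x ∧ ‖p.1 1‖ ^ 2 = y ∧ ‖p.1 2‖ ^ 2 = z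
    · obtain ⟨p, rfl, rfl, rfl⟩ := h
      have h1 := hF (permuteMomenta (Equiv.swap 1 2) p)
      rw [contract_permuteMomenta hbose] at h1
      simp only [volumeTensor_comp_swap] at h1
      rw [hF p]
      refine Eq.trans h1 ?_
      change contract (Γ p) (fun m => -volumeTensor (p.1 2 - p.1 1) m) = _
      congr 1
      ext m
      rw [show p.1 2 - p.1 1 = (-1 : ℝ) • (p.1 1 - p.1 2) by module, volumeTensor_smul]
      ring
    · rw [hF0 x y z h, hF0 x z y]
      rintro ⟨p, h0, h1, h2⟩
      exact h ⟨permuteMomenta (Equiv.swap 1 2) p, h0, h2, h1⟩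
  · by_cases h : ∃ p : conservedTriples, ‖p.1 0‖ ^ 2 = x ∧ ‖p.1 1‖ ^ 2 = y ∧ ‖p.1 2‖ ^ 2 = z
    · obtain ⟨p, rfl, rfl, rfl⟩ := h
      rw [hF, hrot, hrot', ← contract_add_right, ← contract_add_right]
      refine Finset.sum_eq_zero fun m _ => ?_
      simp only [Pi.add_apply, ← volumeTensor_add]
      rw [show p.1 1 - p.1 2 + (p.1 2 - p.1 0) + (p.1 0 - p.1 1) = (0 : ℝ) • p.1 0 by module,
        volumeTensor_smul]
      simp
    · rw [hF0 x y z h, hF0 y z x, hF0 z x y, add_zero, add_zero]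
      · rintro ⟨p, h0, h1, h2⟩
        exact h ⟨permuteMomenta (finRotate 3) p, h1, h2, h0⟩
      · rintro ⟨p, h0, h1, h2⟩
        exact h ⟨permuteMomenta (finRotate 3)⁻¹ p, h2, h0, h1⟩

/-- Here `a, b, c` are the coordinates of collinear momenta. Since `a + b = -c`, the combination `a²
+ b² - c (a + b)` equals `a² + b² + c²` and cancels the denominator. -/
theorem axial_coefficient_identity {K : Type*} [Field K] {t N a b c : K} (hN : N ≠ 0)
    (hS : a ^ 2 + b ^ 2 + c ^ 2 ≠ 0) (hc : a + b + c = 0) :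
    -(t * (c - a) * N) / (N * (a ^ 2 + b ^ 2 + c ^ 2)) * a -
      -(t * (b - c) * N) / (N * (b ^ 2 + a ^ 2 + c ^ 2)) * b = t := by
  rw [add_comm (b ^ 2) (a ^ 2)]
  field_simp
  linear_combination (-t * c) * hc

theorem exists_axial_part {Γ : conservedTriples → ThreeTensor 𝕜}
    (hcov : IsAxialCovariant Γ) (hbose : IsBoseSymmetric Γ) :
    ∃ A : ℝ → ℝ → ℝ → 𝕜, HasBoseRelations A ∧
      ∀ p, IsCollinear p → (Γ - axialTensor A 0) p = 0 := by
  obtain ⟨F, hF, hsymm, hcyc⟩ := exists_invariant_volume hcov hbose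
  let N : ℝ := ∑ m : Fin 3 → Fin 4, leviCivita 0 (m 0) (m 1) (m 2) ^ 2
  have hN : 0 < N := by
    refine Finset.sum_pos' (fun m _ => sq_nonneg _) ⟨![1, 2, 3], Finset.mem_univ _, ?_⟩
    change 0 < leviCivita 0 1 2 3 ^ 2
    rw [leviCivita_zero_one_two_three]
    norm_num
  have hN' : (N : 𝕜) ≠ 0 := RCLike.ofReal_ne_zero.2 hN.ne'
  -- `F` is symmetric in its last two arguments and `A` must be symmetric in its outer ones, hence
  -- the exchange of `x` and `y`. The symmetric denominator preserves the cyclic relation, also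
  -- where it is zero.
  let A : ℝ → ℝ → ℝ → 𝕜 := fun x y z => -F y x z / ((N * (x + y + z) : ℝ) : 𝕜)
  have hcov' := hcov.sub (isAxialCovariant_axialTensor A 0)
  refine ⟨A, ⟨fun x y z => ?_, fun x y z => ?_⟩, fun p hp => ?_⟩
  · simp only [A, hsymm y x z, show z + y + x = x + y + z by ring]
  · simp only [A, show y + z + x = x + y + z by ring, show z + x + y = x + y + z by ring]
    rw [← add_div, ← add_div, hsymm y z x, hsymm z x y, hsymm x y z]
    have h := hcyc x y z
    rw [show -F y z x + -F z x y + -F x y z = -(F x y z + F y z x + F z x y) by ring, h, neg_zero,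
      zero_div]
  · obtain ⟨R, hR, hq⟩ := hp.exists_rotate
    refine hcov'.eq_zero_of_rotate hR ?_
    set q := rotateMomenta R p
    by_cases hq0 : q = 0
    · rw [hq0, hcov'.apply_zero]
    refine hcov'.eq_zero_of_axis hq ?_
    have hsub : ∀ i j k, k ≠ 0 → (q.1 i - q.1 j) k = 0 := fun i j k hk => by
      rw [PiLp.sub_apply, hq i k hk, hq j k hk, sub_zero]
    set t := Γ q ![1, 2, 3] with ht
    have hcon : ∀ i j, contract (Γ q) (volumeTensor (q.1 i - q.1 j)) =
        t * ((q.1 i 0 - q.1 j 0 : ℝ) : 𝕜) * (N : 𝕜) := by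
      intro i j
      simp only [contract, N, RCLike.ofReal_sum, Finset.mul_sum]
      refine Finset.sum_congr rfl fun m _ => ?_
      rw [hcov.eq_leviCivita_of_axis hq, volumeTensor_of_axis (hsub i j), PiLp.sub_apply]
      push_cast
      ring
    have hF1 : F (‖q.1 0‖ ^ 2) (‖q.1 1‖ ^ 2) (‖q.1 2‖ ^ 2) =
        t * ((q.1 1 0 - q.1 2 0 : ℝ) : 𝕜) * (N : 𝕜) := (hF q).trans (hcon 1 2)
    have hF2 : F (‖q.1 1‖ ^ 2) (‖q.1 0‖ ^ 2) (‖q.1 2‖ ^ 2) =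
        t * ((q.1 2 0 - q.1 0 0 : ℝ) : 𝕜) * (N : 𝕜) := by
      rw [← hcon 2 0, hsymm]
      have h1 := hF (permuteMomenta (finRotate 3) q)
      rw [contract_permuteMomenta hbose] at h1
      simp only [volumeTensor_comp_finRotate] at h1
      exact h1
    have hsum : q.1 0 0 + q.1 1 0 + q.1 2 0 = 0 := by
      have := congrArg (fun v : Momentum => v 0) (sum_conservedTriples q)
      simpa using this
    have hS : q.1 0 0 ^ 2 + q.1 1 0 ^ 2 + q.1 2 0 ^ 2 ≠ 0 := by
      intro h0
      have hz : ∀ i, q.1 i 0 = 0 := by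
        intro i
        fin_cases i
        · change q.1 0 0 = 0
          nlinarith [sq_nonneg (q.1 0 0), sq_nonneg (q.1 1 0), sq_nonneg (q.1 2 0)]
        · change q.1 1 0 = 0
          nlinarith [sq_nonneg (q.1 0 0), sq_nonneg (q.1 1 0), sq_nonneg (q.1 2 0)]
        · change q.1 2 0 = 0
          nlinarith [sq_nonneg (q.1 0 0), sq_nonneg (q.1 1 0), sq_nonneg (q.1 2 0)]
      refine hq0 (Subtype.ext (funext fun i => ?_))
      ext k
      by_cases hk : k = 0
      · rw [hk, hz]; rfl
      · rw [hq i k hk]; rfl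
    have hS' : ((q.1 0 0 : ℝ) : 𝕜) ^ 2 + ((q.1 1 0 : ℝ) : 𝕜) ^ 2 + ((q.1 2 0 : ℝ) : 𝕜) ^ 2 ≠ 0 := by
      have := (RCLike.ofReal_ne_zero (K := 𝕜)).2 hS
      push_cast at this
      exact this
    have hc : ((q.1 0 0 : ℝ) : 𝕜) + ((q.1 1 0 : ℝ) : 𝕜) + ((q.1 2 0 : ℝ) : 𝕜) = 0 := by
      rw [← RCLike.ofReal_add, ← RCLike.ofReal_add, hsum, RCLike.ofReal_zero]
    have hax : axialTensor A 0 q ![1, 2, 3] = t := by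
      simp only [axialTensor, axialForm_eq, atSquares, A, Pi.zero_apply, zero_mul, add_zero,
        Matrix.cons_val, volumeTensor_of_axis (hq _), leviCivita_zero_one_two_three, mul_one]
      rw [hF1, hF2, norm_sq_of_axis (hq 0), norm_sq_of_axis (hq 1), norm_sq_of_axis (hq 2)]
      push_cast
      exact axial_coefficient_identity hN' hS' hc
    rw [Pi.sub_apply, Pi.sub_apply, hax, ht, sub_self]

/-! ### Non-collinear momenta and the function `B` -/

theorem sum_tensorIndices {M : Type*} [AddCommMonoid M] (f : (Fin 3 → Fin 4) → M) :
    ∑ m, f m = ∑ i, ∑ j, ∑ k, f ![i, j, k] := by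
  simp only [← Fintype.sum_prod_type' (f := fun j k => f ![_, j, k])]
  rw [← Fintype.sum_prod_type' (f := fun i (jk : Fin 4 × Fin 4) => f ![i, jk.1, jk.2])]
  refine Fintype.sum_equiv
    ⟨fun m => (m 0, m 1, m 2), fun x => ![x.1, x.2.1, x.2.2], fun m => ?_, fun x => rfl⟩ _ _
    fun m => ?_
  · ext k
    fin_cases k <;> rfl
  · congr 1
    ext k
    fin_cases k <;> rfl

theorem leviCivitaContract_eq_of_planar {p q : Momentum} (hp : p 2 = 0 ∧ p 3 = 0)
    (hq : q 2 = 0 ∧ q 3 = 0) (μ ν : Fin 4) :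
    leviCivitaContract p q μ ν = (p 0 * q 1 - p 1 * q 0) * leviCivita 0 1 μ ν := by
  have h0 : ∀ α, leviCivita α α μ ν = 0 := fun α => by linarith [leviCivita_swap₀₁ α α μ ν]
  simp only [leviCivitaContract, Fin.sum_univ_four, hp.1, hp.2, hq.1, hq.2, h0,
    leviCivita_swap₀₁ 0 1 μ ν]
  ring

theorem leviCivita_zero_one_eq_zero {μ ν : Fin 4} (h : μ = 0 ∨ μ = 1 ∨ ν = 0 ∨ ν = 1 ∨ μ = ν) :
    leviCivita 0 1 μ ν = 0 := by
  have e : ∀ i j : Fin 4, i ≠ j → ![0, 1, μ, ν] i = ![0, 1, μ, ν] j → leviCivita 0 1 μ ν = 0 := by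
    intro i j hij hr
    refine det_zero_of_row_eq hij ?_
    ext k
    rw [submatrix_apply, submatrix_apply, hr]
  rcases h with h | h | h | h | h
  · exact e 0 2 (by decide) h.symm
  · exact e 1 2 (by decide) h.symm
  · exact e 0 3 (by decide) h.symm
  · exact e 1 3 (by decide) h.symm
  · exact e 2 3 (by decide) h

theorem leviCivita_zero_one_three_two : leviCivita 0 1 3 2 = -1 := by
  rw [leviCivita_swap₂₃, leviCivita_zero_one_two_three]

theorem contract_tensorVolume_of_planar (T : ThreeTensor 𝕜) {w p q : Momentum}
    (hw : w 2 = 0 ∧ w 3 = 0) (hp : p 2 = 0 ∧ p 3 = 0) (hq : q 2 = 0 ∧ q 3 = 0) :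
    contract T (tensorVolume w p q) = ((p 0 * q 1 - p 1 * q 0 : ℝ) : 𝕜) *
      (((w 0 : ℝ) : 𝕜) * (T ![0, 2, 3] - T ![0, 3, 2]) +
        ((w 1 : ℝ) : 𝕜) * (T ![1, 2, 3] - T ![1, 3, 2])) := by
  have h : ∀ i j k : Fin 4, tensorVolume w p q ![i, j, k] =
      w i * ((p 0 * q 1 - p 1 * q 0) * leviCivita 0 1 j k) := fun i j k => by
    rw [← leviCivitaContract_eq_of_planar hp hq]
    rfl
  simp only [contract, sum_tensorIndices, h, Fin.sum_univ_four, hw.1, hw.2]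
  simp [leviCivita_zero_one_eq_zero, leviCivita_zero_one_two_three, leviCivita_zero_one_three_two]
  ring

theorem planar_of_not_isCollinear {p : conservedTriples} (hc : ¬ IsCollinear p)
    (hp : ∀ i, p.1 i 2 = 0 ∧ p.1 i 3 = 0) :
    p.1 0 0 * p.1 1 1 - p.1 0 1 * p.1 1 0 ≠ 0 := by
  intro hD
  have h2 : p.1 2 = -(p.1 0 + p.1 1) := eq_neg_of_add_eq_zero_right (sum_conservedTriples p)
  have key : ∀ (v : Momentum) (a b : ℝ), p.1 0 = a • v → p.1 1 = b • v → False := by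
    intro v a b ha hb
    refine hc ⟨v, fun i => ?_⟩
    fin_cases i
    · exact ⟨a, ha⟩
    · exact ⟨b, hb⟩
    · refine ⟨-(a + b), ?_⟩
      change p.1 2 = _
      rw [h2, ha, hb]
      module
  have hvec : ∀ u v : Momentum, (u 2 = 0 ∧ u 3 = 0) → (v 2 = 0 ∧ v 3 = 0) → u 0 = v 0 →
      u 1 = v 1 → u = v := by
    intro u v hu hv h0 h1
    ext k
    fin_cases k
    exacts [h0, h1, hu.1.trans hv.1.symm, hu.2.trans hv.2.symm]
  have hsm : ∀ (c : ℝ) (v : Momentum), (v 2 = 0 ∧ v 3 = 0) →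
      (c • v) 2 = 0 ∧ (c • v) 3 = 0 := fun c v hv => by simp [hv.1, hv.2]
  by_cases h0 : p.1 0 0 = 0
  · by_cases h1 : p.1 0 1 = 0
    · refine key (p.1 1) 0 1 (hvec _ _ (hp 0) (hsm _ _ (hp 1)) ?_ ?_) (one_smul _ _).symm
      · simp [h0]
      · simp [h1]
    · refine key (p.1 0) 1 (p.1 1 1 / p.1 0 1) (one_smul _ _).symm
        (hvec _ _ (hp 1) (hsm _ _ (hp 0)) ?_ ?_)
      · rw [h0, zero_mul, zero_sub, neg_eq_zero, mul_eq_zero] at hD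
        simp [h0, hD.resolve_left h1]
      · simp [h1]
  · refine key (p.1 0) 1 (p.1 1 0 / p.1 0 0) (one_smul _ _).symm
      (hvec _ _ (hp 1) (hsm _ _ (hp 0)) ?_ ?_)
    · simp [h0]
    · simp only [PiLp.smul_apply, smul_eq_mul]
      field_simp
      linarith

theorem IsCollinear.of_rotate {R : Matrix (Fin 4) (Fin 4) ℝ} (hR : R ∈ orthogonalGroup (Fin 4) ℝ)
    {p : conservedTriples} (h : IsCollinear (rotateMomenta R p)) : IsCollinear p := by
  obtain ⟨v, hv⟩ := h
  refine ⟨toEuclideanLin Rᵀ v, fun i => ?_⟩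
  obtain ⟨c, hc⟩ := hv i
  refine ⟨c, ?_⟩
  have h1 : p = rotateMomenta Rᵀ (rotateMomenta R p) := by
    rw [rotateMomenta_mul, (mem_orthogonalGroup_iff' _ _).1 hR, rotateMomenta_one]
  rw [← map_smul, ← hc]
  exact congrFun (congrArg Subtype.val h1) i

theorem IsCollinear.of_permute {σ : Equiv.Perm (Fin 3)} {p : conservedTriples}
    (h : IsCollinear (permuteMomenta σ p)) : IsCollinear p := by
  obtain ⟨v, hv⟩ := h
  refine ⟨v, fun i => ?_⟩
  obtain ⟨c, hc⟩ := hv (σ.symm i)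
  exact ⟨c, by rw [← hc, permuteMomenta_apply, Equiv.apply_symm_apply]⟩

/-- The combination `p₃² p₂ - (p₂ · p₃) p₃` of the momenta, which is orthogonal to `p₃`. -/
noncomputable def dualMomentum (p : conservedTriples) : Momentum :=
  (‖p.1 2‖ ^ 2) • p.1 1 - (inner ℝ (p.1 1) (p.1 2) : ℝ) • p.1 2

theorem isEquivariantMomentum_dualMomentum : IsEquivariantMomentum dualMomentum :=
  ((isEquivariantMomentum_apply 1).invariant_smul (norm_sq_invariant 2)).sub
    ((isEquivariantMomentum_apply 2).invariant_smul
      (fun _ hR _ => inner_toEuclideanLin_of_mem_orthogonalGroup hR _ _))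

/-- The tensor that extracts the scalar function `B(3,1,2)` from the amplitude. -/
noncomputable def dualTensor (p : conservedTriples) : ThreeTensor ℝ :=
  tensorVolume (dualMomentum p) (p.1 0) (p.1 1)

theorem isAxialCovariant_dualTensor : IsAxialCovariant (𝕜 := ℝ) dualTensor :=
  isAxialCovariant_tensorVolume isEquivariantMomentum_dualMomentum (isEquivariantMomentum_apply 0)
    (isEquivariantMomentum_apply 1)

theorem norm_sq_of_planar {v : Momentum} (hv : v 2 = 0 ∧ v 3 = 0) :
    ‖v‖ ^ 2 = v 0 ^ 2 + v 1 ^ 2 := by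
  simp [EuclideanSpace.norm_sq_eq, Fin.sum_univ_four, hv.1, hv.2]

theorem inner_of_planar {u v : Momentum} (hv : v 2 = 0 ∧ v 3 = 0) :
    inner ℝ u v = u 0 * v 0 + u 1 * v 1 := by
  simp [EuclideanSpace.inner_eq_star_dotProduct, dotProduct, Fin.sum_univ_four, hv.1, hv.2]
  ring

theorem two_of_planar (p : conservedTriples) (k : Fin 4) :
    p.1 2 k = -p.1 0 k - p.1 1 k := by
  have := congrArg (fun v : Momentum => v k) (sum_conservedTriples p)
  simp only [PiLp.add_apply, PiLp.zero_apply] at this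
  linarith

theorem dualMomentum_planar {p : conservedTriples} (hp : ∀ i, p.1 i 2 = 0 ∧ p.1 i 3 = 0) :
    dualMomentum p 2 = 0 ∧ dualMomentum p 3 = 0 := by
  simp [dualMomentum, hp]

theorem dualMomentum_zero_of_planar {p : conservedTriples}
    (hp : ∀ i, p.1 i 2 = 0 ∧ p.1 i 3 = 0) :
    dualMomentum p 0 = (p.1 0 0 * p.1 1 1 - p.1 0 1 * p.1 1 0) * p.1 2 1 := by
  simp only [dualMomentum, PiLp.sub_apply, PiLp.smul_apply, smul_eq_mul,
    norm_sq_of_planar (hp 2), inner_of_planar (hp 2), two_of_planar]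
  ring

theorem dualMomentum_one_of_planar {p : conservedTriples}
    (hp : ∀ i, p.1 i 2 = 0 ∧ p.1 i 3 = 0) :
    dualMomentum p 1 = (p.1 0 0 * p.1 1 1 - p.1 0 1 * p.1 1 0) * -p.1 2 0 := by
  simp only [dualMomentum, PiLp.sub_apply, PiLp.smul_apply, smul_eq_mul,
    norm_sq_of_planar (hp 2), inner_of_planar (hp 2), two_of_planar]
  ring

theorem contract_dualTensor_of_planar {Γ : conservedTriples → ThreeTensor 𝕜}
    (h : IsAxialCovariant Γ) {p : conservedTriples} (hp : ∀ i, p.1 i 2 = 0 ∧ p.1 i 3 = 0) :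
    contract (Γ p) (dualTensor p) =
      ((2 * (p.1 0 0 * p.1 1 1 - p.1 0 1 * p.1 1 0) ^ 2 : ℝ) : 𝕜) *
      (((p.1 2 1 : ℝ) : 𝕜) * Γ p ![0, 2, 3] - ((p.1 2 0 : ℝ) : 𝕜) * Γ p ![1, 2, 3]) := by
  have hs : ∀ i : Fin 4, i = 0 ∨ i = 1 → Γ p ![i, 3, 2] = -Γ p ![i, 2, 3] := by
    intro i hi
    rw [← h.comp_swap_indices (k := 2) (l := 3) (by decide) (fun i => (hp i).1)
      (fun i => (hp i).2)]
    congr 1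
    rcases hi with rfl | rfl <;> decide
  rw [dualTensor, contract_tensorVolume_of_planar _ (dualMomentum_planar hp) (hp 0) (hp 1),
    dualMomentum_zero_of_planar hp, dualMomentum_one_of_planar hp, hs 0 (Or.inl rfl),
    hs 1 (Or.inr rfl)]
  push_cast
  ring

/-- In the plane, the vanishing contraction says that the vector `(Γ_{023}, Γ_{123})` is parallel to
`p₃`. Bose symmetry makes it parallel to `p₂` as well, so it is zero for independent momenta;
permutations of the legs give the other components. -/
theorem eq_zero_of_contract_dualTensor {Γ : conservedTriples → ThreeTensor 𝕜}
    (hcov : IsAxialCovariant Γ) (hbose : IsBoseSymmetric Γ)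
    (h : ∀ p, ¬ IsCollinear p → contract (Γ p) (dualTensor p) = 0) {p : conservedTriples}
    (hp : ¬ IsCollinear p) : Γ p = 0 := by
  have hperm : ∀ (σ : Equiv.Perm (Fin 3)) (q : conservedTriples) (m m' : Fin 3 → Fin 4),
      (∀ i, m' i = m (σ i)) → Γ (permuteMomenta σ q) m' = Γ q m := fun σ q m m' hm => by
    rw [← hbose σ q m, funext hm]
  have h1 : ∀ q, ¬ IsCollinear q → (∀ i, q.1 i 2 = 0 ∧ q.1 i 3 = 0) →
      ((q.1 2 1 : ℝ) : 𝕜) * Γ q ![0, 2, 3] - ((q.1 2 0 : ℝ) : 𝕜) * Γ q ![1, 2, 3] = 0 := by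
    intro q hq hpl
    have hD := planar_of_not_isCollinear hq hpl
    have h2 := h q hq
    rw [contract_dualTensor_of_planar hcov hpl] at h2
    refine (mul_eq_zero.1 h2).resolve_left (RCLike.ofReal_ne_zero.2 ?_)
    exact mul_ne_zero two_ne_zero (pow_ne_zero 2 hD)
  have h2 : ∀ q, ¬ IsCollinear q → (∀ i, q.1 i 2 = 0 ∧ q.1 i 3 = 0) →
      ∀ i : Fin 4, i = 0 ∨ i = 1 → Γ q ![i, 2, 3] = 0 := by
    intro q hq hpl
    have hD := planar_of_not_isCollinear hq hpl
    have ha := h1 q hq hpl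
    have hb := h1 (permuteMomenta (Equiv.swap 1 2) q) (fun hc => hq hc.of_permute)
      (fun i => hpl (Equiv.swap 1 2 i))
    have hs : ∀ i : Fin 4, i = 0 ∨ i = 1 →
        Γ (permuteMomenta (Equiv.swap 1 2) q) ![i, 2, 3] = -Γ q ![i, 2, 3] := by
      intro i hi
      rw [hperm _ q ![i, 3, 2] _ (by rcases hi with rfl | rfl <;> decide),
        ← hcov.comp_swap_indices (k := 2) (l := 3) (by decide) (fun i => (hpl i).1)
        (fun i => (hpl i).2)]
      congr 1
      rcases hi with rfl | rfl <;> decide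
    rw [hs 0 (Or.inl rfl), hs 1 (Or.inr rfl)] at hb
    change ((q.1 1 1 : ℝ) : 𝕜) * _ - ((q.1 1 0 : ℝ) : 𝕜) * _ = 0 at hb
    rw [two_of_planar, two_of_planar] at ha
    have hD' : ((q.1 0 0 : ℝ) : 𝕜) * ((q.1 1 1 : ℝ) : 𝕜) -
        ((q.1 0 1 : ℝ) : 𝕜) * ((q.1 1 0 : ℝ) : 𝕜) ≠ 0 := by
      have := (RCLike.ofReal_ne_zero (K := 𝕜)).2 hD
      push_cast at this
      exact this
    push_cast at ha
    rintro i (rfl | rfl)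
    -- Cramer's rule for the two equations `ha` and `hb`, whose determinant is nonzero by
    -- non-collinearity.
    · refine (mul_eq_zero.1 ?_).resolve_left hD'
      linear_combination ((q.1 1 0 : ℝ) : 𝕜) * (ha - hb) - ((q.1 0 0 : ℝ) : 𝕜) * hb
    · refine (mul_eq_zero.1 ?_).resolve_left hD'
      linear_combination ((q.1 1 1 : ℝ) : 𝕜) * (ha - hb) - ((q.1 0 1 : ℝ) : 𝕜) * hb
  obtain ⟨R, hR, hpl⟩ := exists_orthogonal_planar p
  refine hcov.eq_zero_of_rotate hR (hcov.eq_zero_of_planar hpl fun i hi => ?_)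
  have hq : ¬ IsCollinear (rotateMomenta R p) := fun hc => hp (hc.of_rotate hR)
  set q := rotateMomenta R p
  refine ⟨h2 q hq hpl i hi, ?_, ?_⟩
  · rw [← hperm (Equiv.swap 0 1) q ![2, i, 3] ![i, 2, 3]
      (by rcases hi with rfl | rfl <;> decide)]
    exact h2 _ (fun hc => hq hc.of_permute) (fun _ => hpl _) i hi
  · rw [← hperm (finRotate 3)⁻¹ q ![2, 3, i] ![i, 2, 3]
      (by rcases hi with rfl | rfl <;> decide)]
    exact h2 _ (fun hc => hq hc.of_permute) (fun _ => hpl _) i hi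

theorem axialTensor_zero_of_planar (B : ℝ → ℝ → ℝ → 𝕜) {p : conservedTriples}
    (hp : ∀ i, p.1 i 2 = 0 ∧ p.1 i 3 = 0) {i : Fin 4} (hi : i = 0 ∨ i = 1) :
    axialTensor 0 B p ![i, 2, 3] =
      (atSquares B p 2 0 1 * ((p.1 1 i : ℝ) : 𝕜) + atSquares B p 1 0 2 * ((p.1 2 i : ℝ) : 𝕜)) *
        ((p.1 0 0 * p.1 1 1 - p.1 0 1 * p.1 1 0 : ℝ) : 𝕜) := by
  have h1 : leviCivita 0 1 3 i = 0 := leviCivita_zero_one_eq_zero (by tauto)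
  have h2 : leviCivita 0 1 i 2 = 0 := leviCivita_zero_one_eq_zero (by tauto)
  simp only [axialTensor, axialForm_eq, Matrix.cons_val,
    leviCivitaContract_eq_of_planar (hp 0) (hp 1), h1, h2, leviCivita_zero_one_two_three]
  simp [atSquares]

theorem axialTensor_zero_of_isCollinear (B : ℝ → ℝ → ℝ → 𝕜) {p : conservedTriples}
    (hp : IsCollinear p) : axialTensor 0 B p = 0 := by
  obtain ⟨R, hR, hq⟩ := hp.exists_rotate
  refine (isAxialCovariant_axialTensor 0 B).eq_zero_of_rotate hR ?_
  set q := rotateMomenta R p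
  have hpl : ∀ i, q.1 i 2 = 0 ∧ q.1 i 3 = 0 := fun i => ⟨hq i 2 (by decide), hq i 3 (by decide)⟩
  ext m
  simp [axialTensor, axialForm_eq, leviCivitaContract_eq_of_planar (hpl 0) (hpl 1),
    hq _ 1 (by decide), atSquares]

/-- A covariant Bose symmetric tensor is determined off the collinear set by its contraction with
`dualTensor`, so `B` only has to reproduce this one invariant. -/
theorem exists_planar_part {Γ : conservedTriples → ThreeTensor 𝕜}
    (hcov : IsAxialCovariant Γ) (hbose : IsBoseSymmetric Γ) (hcol : ∀ p, IsCollinear p → Γ p = 0) :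
    ∃ B : ℝ → ℝ → ℝ → 𝕜, Γ = axialTensor 0 B := by
  obtain ⟨F, hF, -⟩ := exists_eq_norm_sq_of_invariant
    (fun p => contract (Γ p) (dualTensor p)) (fun R hR p => contract_rotate hcov
      isAxialCovariant_dualTensor hR p)
  -- The bracket `x y - ((z - x - y) / 2)²` is the Gram determinant `D²` of `p₁, p₂`. The `B`-tensor
  -- contracts with `dualTensor` to `2 D⁴ B(3,1,2)`: the `p₃` term drops out by orthogonality.
  let B : ℝ → ℝ → ℝ → 𝕜 := fun z x y =>
    F x y z / ((2 * (x * y - ((z - x - y) / 2) ^ 2) ^ 2 : ℝ) : 𝕜)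
  have hcovB := isAxialCovariant_axialTensor 0 B
  have hcov' := hcov.sub hcovB
  have hbose' := hbose.sub (isBoseSymmetric_axialTensor (A := 0) ⟨by simp, by simp⟩ B)
  refine ⟨B, ?_⟩
  rw [← sub_eq_zero]
  ext1 p
  by_cases hp : IsCollinear p
  · rw [Pi.sub_apply, hcol p hp, axialTensor_zero_of_isCollinear B hp, sub_zero]
    rfl
  refine eq_zero_of_contract_dualTensor hcov' hbose' (fun p hp => ?_) hp
  obtain ⟨R, hR, hpl⟩ := exists_orthogonal_planar p
  have hq : ¬ IsCollinear (rotateMomenta R p) := fun hc => hp (hc.of_rotate hR)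
  rw [← contract_rotate hcov' isAxialCovariant_dualTensor hR]
  set q := rotateMomenta R p
  have hD := planar_of_not_isCollinear hq hpl
  have hgram : ‖q.1 0‖ ^ 2 * ‖q.1 1‖ ^ 2 - ((‖q.1 2‖ ^ 2 - ‖q.1 0‖ ^ 2 - ‖q.1 1‖ ^ 2) / 2) ^ 2 =
      (q.1 0 0 * q.1 1 1 - q.1 0 1 * q.1 1 0) ^ 2 := by
    rw [norm_sq_of_planar (hpl 0), norm_sq_of_planar (hpl 1), norm_sq_of_planar (hpl 2),
      two_of_planar, two_of_planar]
    ring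
  have hB : atSquares B q 2 0 1 = contract (Γ q) (dualTensor q) /
      ((2 * ((q.1 0 0 * q.1 1 1 - q.1 0 1 * q.1 1 0) ^ 2) ^ 2 : ℝ) : 𝕜) := by
    rw [← hF q, ← hgram]
    rfl
  have hne : ((2 * ((q.1 0 0 * q.1 1 1 - q.1 0 1 * q.1 1 0) ^ 2) ^ 2 : ℝ) : 𝕜) ≠ 0 :=
    RCLike.ofReal_ne_zero.2 (mul_ne_zero two_ne_zero (pow_ne_zero 2 (pow_ne_zero 2 hD)))
  have hsub : contract ((Γ - axialTensor 0 B) q) (dualTensor q) =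
      contract (Γ q) (dualTensor q) - contract (axialTensor 0 B q) (dualTensor q) := by
    simp [contract, sub_mul]
  rw [eq_div_iff hne] at hB
  rw [hsub, ← hB, contract_dualTensor_of_planar hcovB hpl,
    axialTensor_zero_of_planar B hpl (Or.inl rfl), axialTensor_zero_of_planar B hpl (Or.inr rfl),
    two_of_planar, two_of_planar]
  push_cast
  ring

theorem exists_axialTensor_eq {Γ : conservedTriples → ThreeTensor 𝕜}
    (hcov : IsAxialCovariant Γ) (hbose : IsBoseSymmetric Γ) :
    ∃ A B : ℝ → ℝ → ℝ → 𝕜, HasBoseRelations A ∧ Γ = axialTensor A B := by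
  obtain ⟨A, hA, hcol⟩ := exists_axial_part hcov hbose
  obtain ⟨B, hB⟩ := exists_planar_part (hcov.sub (isAxialCovariant_axialTensor A 0))
    (hbose.sub (isBoseSymmetric_axialTensor hA 0)) hcol
  exact ⟨A, B, hA, by rw [← axialTensor_add, ← hB, add_sub_cancel]⟩

/-! ### Local contributions at zero momentum -/

theorem rotateMomenta_smul (R : Matrix (Fin 4) (Fin 4) ℝ) (t : ℝ) (p : conservedTriples) :
    rotateMomenta R (t • p) = t • rotateMomenta R p :=
  Subtype.ext (funext fun i => map_smul (toEuclideanLin R) t (p.1 i))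

theorem hasDerivAt_along_line {Γ : conservedTriples → ThreeTensor 𝕜}
    (h : DifferentiableAt ℝ Γ 0) (p : conservedTriples) (m : Fin 3 → Fin 4) :
    HasDerivAt (fun t : ℝ => Γ (t • p) m) (fderiv ℝ Γ 0 p m) 0 := by
  have h1 : HasDerivAt (fun t : ℝ => t • p) p 0 := by
    simpa using (hasDerivAt_id (0 : ℝ)).smul_const p
  have h2 : HasFDerivAt Γ (fderiv ℝ Γ 0) ((0 : ℝ) • p) := by
    rw [zero_smul]
    exact h.hasFDerivAt
  exact hasDerivAt_pi.1 (h2.comp_hasDerivAt 0 h1) m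

/-- The group acts linearly on momenta, so the covariance law along the line `t • p` can be
differentiated at `t = 0`. -/
theorem IsAxialCovariant.fderiv {Γ : conservedTriples → ThreeTensor 𝕜} (h : IsAxialCovariant Γ)
    (hd : DifferentiableAt ℝ Γ 0) : IsAxialCovariant fun p => fderiv ℝ Γ 0 p := by
  intro R hR p m
  have h1 := hasDerivAt_along_line hd (rotateMomenta R p) m
  simp only [← rotateMomenta_smul, h R hR] at h1
  refine h1.unique (HasDerivAt.fun_sum fun n _ => ?_)
  exact (hasDerivAt_along_line hd p n).const_mul _

theorem IsBoseSymmetric.fderiv {Γ : conservedTriples → ThreeTensor 𝕜} (h : IsBoseSymmetric Γ)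
    (hd : DifferentiableAt ℝ Γ 0) : IsBoseSymmetric fun p => fderiv ℝ Γ 0 p := by
  intro σ p m
  have h1 := hasDerivAt_along_line hd (permuteMomenta σ p) fun i => m (σ i)
  have h2 : ∀ t : ℝ, t • permuteMomenta σ p = permuteMomenta σ (t • p) := fun t => rfl
  simp only [h2, h σ] at h1
  exact h1.unique (hasDerivAt_along_line hd p m)

/-- The momentum-conserving triple with the given first two momenta. -/
def tripleOfPair (v w : Momentum) : conservedTriples :=
  ⟨![v, w, -v - w], by
    change ∑ i, ![v, w, -v - w] i = 0
    rw [Fin.sum_univ_three]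
    simp⟩

theorem tripleOfPair_eq (p : conservedTriples) : tripleOfPair (p.1 0) (p.1 1) = p := by
  have h2 : p.1 2 = -p.1 0 - p.1 1 := by
    rw [← sub_eq_zero, ← sum_conservedTriples p]
    module
  refine Subtype.ext (funext fun i => ?_)
  fin_cases i
  exacts [rfl, rfl, h2.symm]

theorem tripleOfPair_eq_add (v w : Momentum) :
    tripleOfPair v w = tripleOfPair v 0 + tripleOfPair 0 w := by
  refine Subtype.ext (funext fun i => ?_)
  fin_cases i
  · exact (add_zero v).symm
  · exact (zero_add w).symm
  · change -v - w = -v - 0 + (-0 - w)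
    module

theorem isCollinear_tripleOfPair_smul (v : Momentum) (a b : ℝ) :
    IsCollinear (tripleOfPair (a • v) (b • v)) := by
  refine ⟨v, fun i => ?_⟩
  fin_cases i
  · exact ⟨a, rfl⟩
  · exact ⟨b, rfl⟩
  · refine ⟨-a - b, ?_⟩
    change -(a • v) - b • v = _
    module

theorem axialTensor_tripleOfPair (A : ℝ → ℝ → ℝ → 𝕜) (v : Momentum) (a b : ℝ)
    (m : Fin 3 → Fin 4) :
    axialTensor A 0 (tripleOfPair (a • v) (b • v)) m =
      (((a : ℝ) : 𝕜) * A (a ^ 2 * ‖v‖ ^ 2) (b ^ 2 * ‖v‖ ^ 2) ((a + b) ^ 2 * ‖v‖ ^ 2) -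
        ((b : ℝ) : 𝕜) * A (b ^ 2 * ‖v‖ ^ 2) (a ^ 2 * ‖v‖ ^ 2) ((a + b) ^ 2 * ‖v‖ ^ 2)) *
        ((volumeTensor v m : ℝ) : 𝕜) := by
  have e : ![m 0, m 1, m 2] = m := by
    ext k
    fin_cases k <;> rfl
  have hn : ∀ c : ℝ, ‖c • v‖ ^ 2 = c ^ 2 * ‖v‖ ^ 2 := fun c => by
    rw [norm_smul, mul_pow, Real.norm_eq_abs, sq_abs]
  have h0 : (tripleOfPair (a • v) (b • v)).1 0 = a • v := rfl
  have h1 : (tripleOfPair (a • v) (b • v)).1 1 = b • v := rfl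
  have h2 : (tripleOfPair (a • v) (b • v)).1 2 = (-(a + b)) • v := by
    change -(a • v) - b • v = _
    module
  simp only [axialTensor, axialForm_eq, e, atSquares, h0, h1, h2, hn, volumeTensor_smul,
    Pi.zero_apply, neg_sq]
  push_cast
  ring

/-- A linear Bose symmetric amplitude of an axial vector field vanishes. -/
theorem eq_zero_of_linear (D : conservedTriples →ₗ[ℝ] ThreeTensor 𝕜)
    (hcov : IsAxialCovariant fun p => D p) (hbose : IsBoseSymmetric fun p => D p) : D = 0 := by
  obtain ⟨A, ⟨hsymm, hcyc⟩, hA⟩ := exists_axial_part hcov hbose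
  have hD : ∀ v a b m, D (tripleOfPair (a • v) (b • v)) m =
      axialTensor A 0 (tripleOfPair (a • v) (b • v)) m := fun v a b m =>
    sub_eq_zero.1 (congrFun (hA _ (isCollinear_tripleOfPair_smul v a b)) m)
  have key : ∀ v m, D (tripleOfPair v 0) m = 0 ∧ D (tripleOfPair 0 v) m = 0 := by
    intro v m
    have h1 := hD v 1 (-1) m
    have h2 := hD v 1 0 m
    have h3 := hD v 0 1 m
    have h4 := hD v 0 (-1) m
    -- Additivity on `(v, -v, 0) = (v, 0, -v) + (0, -v, v)`. With `s = ‖v‖²` it gives `2 A(s,s,0) =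
    -- 2 A(s,0,s)` up to the factor `ε(v, ·, ·, ·)`, while the relations for `A` give `2 A(s,s,0) +
    -- A(s,0,s) = 0`; hence `3 A(s,0,s)` times that factor vanishes.
    have hadd := congrFun (congrArg D (tripleOfPair_eq_add v (-v))) m
    rw [map_add, Pi.add_apply] at hadd
    have hc := hcyc (‖v‖ ^ 2) (‖v‖ ^ 2) 0
    rw [← hsymm (‖v‖ ^ 2) (‖v‖ ^ 2) 0] at hc
    rw [axialTensor_tripleOfPair] at h1 h2 h3 h4
    norm_num at h1 h2 h3 h4
    rw [h1, h2, h4] at hadd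
    rw [h2, h3]
    have h5 : A (‖v‖ ^ 2) 0 (‖v‖ ^ 2) * ((volumeTensor v m : ℝ) : 𝕜) = 0 := by
      linear_combination (1 / 3 : 𝕜) * ((volumeTensor v m : ℝ) : 𝕜) * hc - (1 / 3 : 𝕜) * hadd
    rw [h5, neg_zero]
    exact ⟨rfl, rfl⟩
  ext p m
  rw [← tripleOfPair_eq p, tripleOfPair_eq_add, map_add, Pi.add_apply, (key _ _).1, (key _ _).2]
  simp

theorem hasNoRelevantLocalPart_of_analyticAt {Γ : conservedTriples → ThreeTensor 𝕜}
    (hcov : IsAxialCovariant Γ) (hbose : IsBoseSymmetric Γ) (h : AnalyticAt ℝ Γ 0) :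
    HasNoRelevantLocalPart Γ := by
  have hd := h.differentiableAt
  have hD := eq_zero_of_linear (fderiv ℝ Γ 0).toLinearMap (hcov.fderiv hd) (hbose.fderiv hd)
  intro n hn
  obtain rfl | rfl : n = 0 ∨ n = 1 := by omega
  · ext1 v
    rw [iteratedFDeriv_zero_apply, hcov.apply_zero]
    rfl
  · ext1 v
    rw [iteratedFDeriv_one_apply]
    exact LinearMap.congr_fun hD (v 0)

end

theorem lemma2 {𝕜 : Type*} [RCLike 𝕜] (Γ : conservedTriples → ThreeTensor 𝕜)
    (hcov : IsAxialCovariant Γ) (hbose : IsBoseSymmetric Γ) :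
    (∃ A B : ℝ → ℝ → ℝ → 𝕜, HasBoseRelations A ∧
      ∀ (p : conservedTriples) (μ ν ρ : Fin 4), Γ p ![μ, ν, ρ] = axialForm A B p μ ν ρ) ∧
    (AnalyticAt ℝ Γ 0 → HasNoRelevantLocalPart Γ) := by
  refine ⟨?_, hasNoRelevantLocalPart_of_analyticAt hcov hbose⟩
  obtain ⟨A, B, hA, hΓ⟩ := exists_axialTensor_eq hcov hbose
  exact ⟨A, B, hA, fun p μ ν ρ => by rw [hΓ]; rfl⟩
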